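/- **Setting.** The system $T$ has a finite state set $S$, actions $A$, a partial transition function $\delta:S\times A\rightharpoonup S$, one initial state $s_0$ and labels $L:S\to 2^{AP}$; a state without outgoing transition is *terminal*. A test harness gives for each $s$ the set $H(s)\subseteq A$ of actions that may be restricted; a transition $(s,s')$ is *restrictable* if every action causing it lies in $H(s)$. The system objective $\varphi_{sys}$ is a conjunction of sub-tasks of the forms $\bigwedge_i\Diamond p^i$ (visit), $\Diamond(p^0\wedge\Diamond(p^1\wedge\dots\Diamond p^m))$ (sequenced visit), $\square\neg p$, $\square(p\to q)$, $\square(p\to\Diamond q)$, containing at least one visit or sequenced visit whose final proposition holds only in terminal states. The test objective $\varphi_{test}$ is a nonempty conjunction of visits and sequenced visits. Let $B_{sys},B_{test}$ be the deterministic automata of the objectives (products of the standard automata of the sub-tasks, with products of the accepting sets $F$), $B_\pi=B_{sys}\otimes B_{test}$ (its states $q=(q_{sys},q_{test})$ are the *history variables*), $G=T\otimes B_\pi$, $G_{sys}=T\otimes B_{sys}$. The node $\mathtt S$ is the initial node of $G$ ($s_0$ with the history obtained by reading $L(s_0)$), $\mathtt T$ is the set of nodes with $q_{sys}\in F_{sys}$,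 $\mathtt I$ the set of nodes with $q_{test}\in F_{test}$, $q_{sys}\notin F_{sys}$, and $\mathtt T_{sys}$ is the set of nodes $(s,q_{sys})$ of $G_{sys}$ with $q_{sys}\in F_{sys}$. Assume that no transition of $G$ from a node reachable from $\mathtt S$ accomplishes the test objective for the first time at the very step that enters $\mathtt T$ (a step into a node of $\mathtt T$ with $q_{test}\in F_{test}$ starts in a node with $q_{test}\in F_{test}$). **Test strategies.** A test strategy $\pi_{test}$ assigns to each finite prefix $s_0\dots s_k$ a set of restricted actions. Against it, a system strategy (a map from prefixes to actions) produces an execution, in which every action is available and not restricted, until a terminal state is reached, which is then repeated forever. The system strategy is *correct* if it has such an execution and the execution satisfies $\varphi_{sys}$. The test environment has static obstacles only, reactive obstacles only, or is mixed (obstacles on transitions in a given set $E_{static}$ must be static). $\pi_{test}$ is *feasible* if 1. the environment realizes it: there are sets $\mathrm{Obs}(\sigma_k)$ of restrictable transitions (membership of static-area transitions being independent of $\sigma_k$; the static area is the set of all transitions, none, or $E_{static}$, respectively) such that $\pi_{test}(\sigma_k)$ is the set of actions that cause a transition in $\mathrm{Obs}(\sigma_k)$ from the current state; and the obstacles do not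 block the system's way to its goal: let $\mathrm{Obs}_q$ be the union of the $\mathrm{Obs}(\sigma_k)$ over the prefixes with history $q$. For every $q$ and every node $u\in \mathtt S_{sys}(q)$ there is a path on $G_{sys}$ from $u$ to $\mathtt T_{sys}$ that uses no transition in $\mathrm{Obs}_q$. Here $\mathtt S_{sys}(q)$ consists of the projections $u\notin\mathtt T_{sys}$ to $G_{sys}$ of the nodes $(s,q)$ of $G$ that are reachable from $\mathtt S$ and either equal $\mathtt S$ or have a reachable predecessor with a history other than $q$, provided a path from $u$ to $\mathtt T_{sys}$ exists on $G_{sys}$. For an environment with static obstacles only, the condition is required only for the projection of $\mathtt S$ and its history; 2. a correct system strategy exists; 3. every execution of a correct system strategy satisfies $\varphi_{sys}\wedge\varphi_{test}$. Two state-history traces are *unique* if they share no two consecutive state-history pairs (the final repetition is not counted). A feasible $\pi_{test}$ is *least restrictive* if the cardinality of a set of pairwise unique state-history traces of executions of correct system strategies is maximal among all feasible test strategies for the same environment. **MILP.** Let $E$ be the set of edges of $G$ and $E_{sys}$ that of $G_{sys}$, both without self-loops. Maximize $F-\frac1{|E|}\sum_{e\in E}d^e$ over $d\in\{0,1\}^E$,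 a flow $f$ of value $F$ from $\mathtt S$ to $\mathtt T$ with unit capacities (no flow into $\mathtt S$ or out of $\mathtt T$), potentials $\mu$ on the nodes outside $\mathtt I$, and flows $f_{sys}^{(q,u)}$, subject to: $d^e=0$ for edges over transitions that are not restrictable; $d^e+f^e\le1$; $0\le\mu\le1$ and $\mu^{\mathtt S}-\mu^{v}\ge1$ for $v\in\mathtt T$ (when $\mathtt S\notin\mathtt I$); $d^{(x,y)}-\mu^x+\mu^y\ge0$ for edges $(x,y)$ with $x,y\notin\mathtt I$; in the reactive and mixed cases, for all $q$ and $u\in\mathtt S_{sys}(q)$, $f_{sys}^{(q,u)}$ is a unit-capacity flow on $G_{sys}$ from $u$ to $\mathtt T_{sys}$ of value at least $1$, with $d^{e}+(f_{sys}^{(q,u)})^{e'}\le1$ whenever $e\in E$ starts at history $q$ and $e'\in E_{sys}$ lies over the same system transition; in the static and mixed cases, $d^e=d^{e'}$ whenever $e,e'$ lie over the same transition in the static area. The data are *consistent* for the environment if the MILP has a feasible point with $F\ge1$. **Theorem.** If the data are consistent, then the MILP of the environment has an optimal solution, and for every optimal solution, with cuts $d^*$, the test strategy $$\pi_{test}(s_0\dots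 s_k)=\{a\mid \delta(s_k,a)=s',\ d^{*\,((s_k,q),(s',q'))}=1\text{ for some }q'\},\quad q=\text{history of }s_0\dots s_k,$$ is feasible and least restrictive. -/

import Mathlib

open scoped Classical

noncomputable section

namespace TestSynth

universe u v w

/-! # Linear temporal logic over infinite words of sets of atomic propositions -/

/-- Syntax of LTL over the atomic propositions `AP`. -/
inductive LTL (AP : Type w) : Type w
  | tt : LTL AP
  | atom : AP → LTL AP
  | conj : LTL AP → LTL AP → LTL AP
  | neg : LTL AP → LTL AP
  | nxt : LTL AP → LTL AP
  | untl : LTL AP → LTL AP → LTL AP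

namespace LTL

variable {AP : Type w}

/-- `HoldsAt ω φ i`: the formula `φ` holds at position `i` of the word `ω`. -/
def HoldsAt (ω : ℕ → Set AP) : LTL AP → ℕ → Prop
  | tt, _ => True
  | atom a, i => a ∈ ω i
  | conj φ ψ, i => HoldsAt ω φ i ∧ HoldsAt ω ψ i
  | neg φ, i => ¬ HoldsAt ω φ i
  | nxt φ, i => HoldsAt ω φ (i + 1)
  | untl φ ψ, i => ∃ k, i ≤ k ∧ HoldsAt ω ψ k ∧ ∀ j, i ≤ j → j < k → HoldsAt ω φ j

/-- A word satisfies a formula if the formula holds at position `0`. -/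
def Sat (ω : ℕ → Set AP) (φ : LTL AP) : Prop := HoldsAt ω φ 0

/-- Eventually. -/
def ev (φ : LTL AP) : LTL AP := untl tt φ

/-- Always. -/
def alw (φ : LTL AP) : LTL AP := neg (ev (neg φ))

/-- Implication. -/
def imp (φ ψ : LTL AP) : LTL AP := neg (conj φ (neg ψ))

/-- Conjunction of a list of formulas. -/
def bigConj : List (LTL AP) → LTL AP
  | [] => tt
  | φ :: l => conj φ (bigConj l)

/-- `◇(p⁰ ∧ ◇(p¹ ∧ … ◇pᵐ))`. -/
def sequenced : List AP → LTL AP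
  | [] => tt
  | [p] => ev (atom p)
  | p :: q :: l => ev (conj (atom p) (sequenced (q :: l)))

end LTL

/-! # Sub-task specification patterns and objectives -/

/-- The five sub-task patterns. -/
inductive Subtask (AP : Type w) : Type w
  | visit (m : ℕ) (p : Fin (m + 1) → AP) : Subtask AP
  | seqVisit (m : ℕ) (p : Fin (m + 1) → AP) : Subtask AP
  | safety (p : AP) : Subtask AP
  | instantReaction (p q : AP) : Subtask AP
  | delayedReaction (p q : AP) : Subtask AP

namespace Subtask

variable {AP : Type w}

/-- The LTL formula of a sub-task. -/
def formula : Subtask AP → LTL AP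
  | visit _ p => LTL.bigConj (List.ofFn fun i => LTL.ev (LTL.atom (p i)))
  | seqVisit _ p => LTL.sequenced (List.ofFn p)
  | safety p => LTL.alw (LTL.neg (LTL.atom p))
  | instantReaction p q => LTL.alw (LTL.imp (LTL.atom p) (LTL.atom q))
  | delayedReaction p q => LTL.alw (LTL.imp (LTL.atom p) (LTL.ev (LTL.atom q)))

/-- Visit and sequenced visit sub-tasks. -/
def IsReach : Subtask AP → Prop
  | visit _ _ => True
  | seqVisit _ _ => True
  | _ => False

/-- The final proposition of a visit or sequenced visit sub-task. -/
def finalProp : Subtask AP → Option AP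
  | visit m p => some (p (Fin.last m))
  | seqVisit m p => some (p (Fin.last m))
  | _ => none

end Subtask

/-- An objective is a conjunction of sub-tasks. -/
abbrev Objective (AP : Type w) := List (Subtask AP)

/-- The LTL formula of an objective. -/
def Objective.formula {AP : Type w} (φ : Objective AP) : LTL AP :=
  LTL.bigConj (List.map Subtask.formula φ)

/-! # Deterministic Büchi automata -/

/-- A (complete) deterministic Büchi automaton over the alphabet `Ω`, with finitely many states. -/
structure DBA (Ω : Type w) where
  Q : Type
  [finQ : Fintype Q]
  step : Q → Ω → Q
  init : Q
  acc : Set Q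

attribute [instance] DBA.finQ

namespace DBA

variable {Ω : Type w}

/-- The product automaton: accepting states are the pairs of accepting states. -/
@[reducible] def prod (B₁ B₂ : DBA Ω) : DBA Ω where
  Q := B₁.Q × B₂.Q
  step q a := (B₁.step q.1 a, B₂.step q.2 a)
  init := (B₁.init, B₂.init)
  acc := {q | q.1 ∈ B₁.acc ∧ q.2 ∈ B₂.acc}

/-- The one-state automaton that accepts every word. -/
@[reducible] def trivial (Ω : Type w) : DBA Ω where
  Q := Unit
  step q _ := q
  init := ()
  acc := Set.univ

/-- The state reached after reading a finite word. -/
def run (B : DBA Ω) (l : List Ω) : B.Q := l.foldl B.step B.init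

end DBA

section Automata

variable {AP : Type w}

/-- One advance of a sequenced visit with progress `k` on the letter `a`: if the `k`-th
proposition is the next one to be visited and it holds, the progress becomes `k + 1`. -/
def seqBump {m : ℕ} (p : Fin (m + 1) → AP) (a : Set AP) (k : Fin (m + 2)) : Fin (m + 2) :=
  if h : (k : ℕ) < m + 1 then
    (if p ⟨k, h⟩ ∈ a then ⟨k + 1, Nat.succ_lt_succ h⟩ else k)
  else k

/-- The deterministic Büchi automaton of a sub-task.
* visit: the set of propositions seen so far;
* sequenced visit: the number of propositions already visited in order (one letter may make
  several of them true, so the progress is advanced as far as possible);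
* safety, instantaneous reaction: `true` until the requirement is violated;
* delayed reaction: `true` while a response is pending. -/
def subtaskBA : Subtask AP → DBA (Set AP)
  | .visit m p =>
      { Q := Set (Fin (m + 1))
        step := fun q a => q ∪ {i | p i ∈ a}
        init := ∅
        acc := {Set.univ} }
  | .seqVisit m p =>
      { Q := Fin (m + 2)
        step := fun k a => (seqBump p a)^[m + 1] k
        init := 0
        acc := {Fin.last (m + 1)} }
  | .safety p =>
      { Q := Bool
        step := fun b a => b && decide (p ∉ a)
        init := true
        acc := {true} }
  | .instantReaction p q =>
      { Q := Bool
        step := fun b a => b && decide (p ∈ a → q ∈ a)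
        init := true
        acc := {true} }
  | .delayedReaction p q =>
      { Q := Bool
        step := fun b a => (b || decide (p ∈ a)) && decide (q ∉ a)
        init := false
        acc := {false} }

/-- The automaton of an objective: the product of the automata of its sub-tasks. -/
def objectiveBA : Objective AP → DBA (Set AP)
  | [] => DBA.trivial _
  | t :: φ => (subtaskBA t).prod (objectiveBA φ)

end Automata

/-! # Systems, test environments, flow networks -/

/-- The system under test: a transition system with one initial state. `δ s a = none` means that
action `a` is not available in state `s`. -/
structure System (S : Type u) (A : Type v) (AP : Type w) where
  δ : S → A → Option S
  s₀ : S
  L : S → Set AP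

namespace System

variable {S : Type u} {A : Type v} {AP : Type w} (T : System S A AP)

/-- The transitions. -/
def Edge (s s' : S) : Prop := ∃ a, T.δ s a = some s'

/-- A terminal state has no outgoing transition. -/
def Terminal (s : S) : Prop := ∀ s', ¬ T.Edge s s'

/-- Finite prefixes `s₀ s₁ … sₖ` of system traces. -/
def IsPrefix (l : List S) : Prop := l.head? = some T.s₀ ∧ List.IsChain T.Edge l

end System

/-- Test environments made of obstacles: only static ones, only reactive ones, or both, where the
transitions in `E_static` can only be blocked by static obstacles. -/
inductive TestEnv (S : Type u) : Type u
  | static : TestEnv S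
  | reactive : TestEnv S
  | mixed (E_static : Set (S × S)) : TestEnv S

/-- The transitions on which obstacles must be static. -/
def TestEnv.staticArea {S : Type u} : TestEnv S → Set (S × S)
  | .static => Set.univ
  | .reactive => ∅
  | .mixed E_static => E_static

/-- A flow network with unit capacities. -/
structure FlowNetwork (V : Type u) where
  E : Set (V × V)
  src : Set V
  snk : Set V

namespace FlowNetwork

variable {V : Type u} [Fintype V] (N : FlowNetwork V)

/-- The edges as a finite set. -/
def edges : Finset (V × V) := Finset.univ.filter fun e => e ∈ N.E

/-- The flow constraints: capacity, conservation, no flow into the sources or out of the sinks. -/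
structure IsFlow (f : V × V → ℝ) : Prop where
  capacity : ∀ e ∈ N.edges, 0 ≤ f e ∧ f e ≤ 1
  conservation : ∀ x, x ∉ N.src → x ∉ N.snk →
    ∑ e ∈ N.edges with e.2 = x, f e = ∑ e ∈ N.edges with e.1 = x, f e
  boundary : ∀ e ∈ N.edges, (e.1 ∈ N.snk ∨ e.2 ∈ N.src) → f e = 0

/-- The flow value: total flow out of the sources. -/
def value (f : V × V → ℝ) : ℝ := ∑ e ∈ N.edges with e.1 ∈ N.src, f e

end FlowNetwork

/-! # Synchronous products -/

section Product

variable {S : Type u} {A : Type v} {AP : Type w} (T : System S A AP) (B : DBA (Set AP))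

/-- The transitions of the synchronous product of `T` and `B`. -/
def ProdEdge (x y : S × B.Q) : Prop := T.Edge x.1 y.1 ∧ B.step x.2 (T.L y.1) = y.2

/-- The initial state of the synchronous product. -/
def prodInit : S × B.Q := (T.s₀, B.step B.init (T.L T.s₀))

/-- The flow network on the synchronous product; self-loops are excluded. -/
def prodNetwork (src snk : Set (S × B.Q)) : FlowNetwork (S × B.Q) where
  E := {e | ProdEdge T B e.1 e.2 ∧ e.1 ≠ e.2}
  src := src
  snk := snk

end Product

/-! # The test synthesis problem -/

/-- Problem data: system, test harness (`H s` is the set of actions that can be restricted in `s`),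
system objective and test objective. -/
structure TestProblem (S : Type u) (A : Type v) (AP : Type w) where
  T : System S A AP
  H : S → Set A
  φsys : Objective AP
  φtest : Objective AP

namespace TestProblem

variable {S : Type u} {A : Type v} {AP : Type w} (P : TestProblem S A AP)

/-- The system objective contains a visit or sequenced visit sub-task whose final proposition holds
only in terminal states. -/
def IsSystemObjective : Prop :=
  ∃ t ∈ P.φsys, ∃ p, t.finalProp = some p ∧ ∀ s, p ∈ P.T.L s → P.T.Terminal s

/-- The test objective is a nonempty conjunction of visit and sequenced visit sub-tasks. -/
def IsTestObjective : Prop := P.φtest ≠ [] ∧ ∀ t ∈ P.φtest, t.IsReach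

/-- The Büchi automaton of the system objective. -/
abbrev Bsys : DBA (Set AP) := objectiveBA P.φsys

/-- The Büchi automaton of the test objective. -/
abbrev Btest : DBA (Set AP) := objectiveBA P.φtest

/-- The specification product; its states are the history variables. -/
abbrev Bπ : DBA (Set AP) := P.Bsys.prod P.Btest

/-- State-history pairs: the nodes of the virtual product graph `G`. -/
abbrev Node := S × P.Bπ.Q

/-- The nodes of the system product graph `G_sys`. -/
abbrev SysNode := S × P.Bsys.Q

/-- The projection from `G` to `G_sys`. -/
def proj (x : P.Node) : P.SysNode := (x.1, x.2.1)

/-- The source node of `G`. -/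
def source : P.Node := prodInit P.T P.Bπ

/-- Target nodes of `G`. -/
def target : Set P.Node := {x | x.2.1 ∈ P.Bsys.acc}

/-- Intermediate nodes of `G`. -/
def inter : Set P.Node := {x | x.2.2 ∈ P.Btest.acc ∧ x.2.1 ∉ P.Bsys.acc}

/-- Target nodes of `G_sys`. -/
def sysTarget : Set P.SysNode := {x | x.2 ∈ P.Bsys.acc}

/-- Nodes of `G` that are reachable from the source. -/
def Reach (x : P.Node) : Prop := Relation.ReflTransGen (ProdEdge P.T P.Bπ) P.source x

/-- The system objective is never reached at the very step at which the test objective is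
accomplished for the first time: a transition of `G` into a target node in which the test objective
is accomplished starts in a node in which it is already accomplished. -/
def TestBeforeGoal : Prop :=
  ∀ x y : P.Node, P.Reach x → ProdEdge P.T P.Bπ x y → y ∈ P.target →
    y.2.2 ∈ P.Btest.acc → x.2.2 ∈ P.Btest.acc

/-- The system transition `e` can be prevented by the harness: every action that causes it can be
restricted. -/
def Restrictable (e : S × S) : Prop := ∀ a, P.T.δ e.1 a = some e.2 → a ∈ P.H e.1

/-! ## Executions and strategies -/

/-- The history variable of a finite prefix. -/
def hist (l : List S) : P.Bπ.Q := P.Bπ.run (l.map P.T.L)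

/-- The prefix `σ₀ … σₖ`. -/
def pre (σ : ℕ → S) (k : ℕ) : List S := (List.range (k + 1)).map σ

/-- `σ` is the execution of the system strategy `πs` against the test strategy `πt`: at every step
the system takes an available, unrestricted action, until it reaches a terminal state; then the
test ends and the last state is repeated forever. -/
def IsExecution (πs : List S → A) (πt : List S → Set A) (σ : ℕ → S) : Prop :=
  σ 0 = P.T.s₀ ∧ ∀ k,
    (P.T.Terminal (σ k) ∧ σ (k + 1) = σ k) ∨
    (πs (pre σ k) ∉ πt (pre σ k) ∧ P.T.δ (σ k) (πs (pre σ k)) = some (σ (k + 1)))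

/-- Satisfaction of an objective by a trace of states. -/
def Satisfies (σ : ℕ → S) (φ : Objective AP) : Prop := LTL.Sat (fun k => P.T.L (σ k)) φ.formula

/-- A system strategy is correct against `πt` if it respects the system model and the restrictions
and its execution satisfies the system objective. -/
def IsCorrect (πt : List S → Set A) (πs : List S → A) : Prop :=
  ∃ σ, P.IsExecution πs πt σ ∧ P.Satisfies σ P.φsys

/-- Executions of correct system strategies. -/
def correctExecutions (πt : List S → Set A) : Set (ℕ → S) :=
  {σ | ∃ πs, P.IsCorrect πt πs ∧ P.IsExecution πs πt σ}

/-- The state-history trace of an execution. -/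
def trace (σ : ℕ → S) (k : ℕ) : P.Node := (σ k, P.hist (pre σ k))

/-- The state-history traces of the executions of correct system strategies. -/
def traces (πt : List S → Set A) : Set (ℕ → P.Node) := P.trace '' P.correctExecutions πt

/-- Two state-history traces are unique if they share no pair of consecutive state-history pairs.
The repetition of the last state after the end of the test is not counted. -/
def Unique (θ₁ θ₂ : ℕ → P.Node) : Prop :=
  ∀ i j, ¬ P.T.Terminal (θ₁ i).1 → ¬ (θ₁ i = θ₂ j ∧ θ₁ (i + 1) = θ₂ (j + 1))

/-- There is a set of `n` unique state-history traces. -/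
def HasUniqueTraces (πt : List S → Set A) (n : ℕ) : Prop :=
  ∃ Θ : Finset (ℕ → P.Node),
    (Θ : Set (ℕ → P.Node)) ⊆ P.traces πt ∧ (Θ : Set (ℕ → P.Node)).Pairwise P.Unique ∧ Θ.card = n

/-! ## First observations of a history variable, system perspective -/

/-- Possible first observations of the history variable `q` in a test execution. -/
def firstObs (q : P.Bπ.Q) : Set P.Node :=
  {x | x.2 = q ∧ P.Reach x ∧
    (x = P.source ∨ ∃ y, P.Reach y ∧ ProdEdge P.T P.Bπ y x ∧ y.2 ≠ q)}

/-- Nodes of `G_sys` that are projections of nodes in `X`, that have not reached the goal, and from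
which there is a path to the goal on `G_sys`. -/
def sysSources (X : Set P.Node) : Set P.SysNode :=
  {u | u ∉ P.sysTarget ∧ (∃ x ∈ X, P.proj x = u) ∧
    ∃ t ∈ P.sysTarget, Relation.ReflTransGen (ProdEdge P.T P.Bsys) u t}

/-- The places from which the system checks the restrictions of history variable `q`: static
obstacles never change, so they are checked at the start of the test; otherwise they are checked
wherever `q` can be observed first. -/
def checkpoints (env : TestEnv S) (q : P.Bπ.Q) : Set P.SysNode :=
  match env with
  | .static => P.sysSources {x | x = P.source ∧ x.2 = q}
  | _ => P.sysSources (P.firstObs q)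

/-! ## Feasible and least restrictive test strategies -/

/-- The test strategy `πt` is realized by placing the obstacles `Obs l` after each prefix `l`. -/
structure Realizes (env : TestEnv S) (Obs : List S → Set (S × S)) (πt : List S → Set A) :
    Prop where
  transitions : ∀ l, ∀ e ∈ Obs l, P.T.Edge e.1 e.2
  harness : ∀ l, ∀ e ∈ Obs l, P.Restrictable e
  static_const : ∀ e ∈ env.staticArea, ∀ l l', e ∈ Obs l ↔ e ∈ Obs l'
  strategy : ∀ l s, P.T.IsPrefix l → l.getLast? = some s →
    πt l = {a | ∃ s', P.T.δ s a = some s' ∧ (s, s') ∈ Obs l}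

/-- All obstacles that may be placed while the history variable is `q`. -/
def obstaclesAt (Obs : List S → Set (S × S)) (q : P.Bπ.Q) : Set (S × S) :=
  {e | ∃ l, P.T.IsPrefix l ∧ P.hist l = q ∧ e ∈ Obs l}

/-- The assumption of the system on the test environment: the obstacles do not block all paths to
the goal. From the perspective of the system (on `G_sys`, taking the obstacles that belong to the
current history variable as they are), there is a path to the goal. -/
def LeavesPath (env : TestEnv S) (Obs : List S → Set (S × S)) : Prop :=
  ∀ q, ∀ u ∈ P.checkpoints env q, ∃ t ∈ P.sysTarget,
    Relation.ReflTransGen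
      (fun x y => ProdEdge P.T P.Bsys x y ∧ (x.1, y.1) ∉ P.obstaclesAt Obs q) u t

/-- Feasibility of a test strategy for a test environment. -/
structure IsFeasible (env : TestEnv S) (πt : List S → Set A) : Prop where
  realizable : ∃ Obs, P.Realizes env Obs πt ∧ P.LeavesPath env Obs
  exists_correct : ∃ πs, P.IsCorrect πt πs
  correct_sat : ∀ πs σ, P.IsCorrect πt πs → P.IsExecution πs πt σ →
    P.Satisfies σ P.φtest ∧ P.Satisfies σ P.φsys

/-- A feasible test strategy that is least restrictive: no feasible test strategy for the same
environment admits a larger set of unique state-history traces. -/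
structure Solves (env : TestEnv S) (πt : List S → Set A) : Prop where
  feasible : P.IsFeasible env πt
  least_restrictive : ∀ πt', P.IsFeasible env πt' →
    ∀ n, P.HasUniqueTraces πt' n → P.HasUniqueTraces πt n

/-! ## The mixed-integer linear programs -/

/-- The flow network on the virtual product graph. -/
def net : FlowNetwork P.Node := prodNetwork P.T P.Bπ {P.source} P.target

/-- The flow network on the system product graph with source `u`. -/
def sysNet (u : P.SysNode) : FlowNetwork P.SysNode := prodNetwork P.T P.Bsys {u} P.sysTarget

/-- The variables: flow `f` and cuts `d` on the edges of `G`, partition variable `μ` on the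
nodes of `G`, and a flow on the edges of `G_sys` for each history variable and source. Values
outside of these index sets are irrelevant. -/
structure MILPPoint where
  f : P.Node × P.Node → ℝ
  d : P.Node × P.Node → ℝ
  μ : P.Node → ℝ
  fsys : P.Bπ.Q → P.SysNode → P.SysNode × P.SysNode → ℝ

variable [Fintype S]

/-- The constraints of the MILP that belongs to the test environment. The constraints on the
system flows are present in the reactive and the mixed case; the static constraints concern the
edges of `G` over the static area. -/
structure MILPFeasible (env : TestEnv S) (x : P.MILPPoint) : Prop where
  binary : ∀ e ∈ P.net.edges, x.d e = 0 ∨ x.d e = 1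
  harness : ∀ e ∈ P.net.edges, ¬ P.Restrictable (e.1.1, e.2.1) → x.d e = 0
  flow : P.net.IsFlow x.f
  cut : ∀ e ∈ P.net.edges, x.d e + x.f e ≤ 1
  potential : ∀ v, v ∉ P.inter → 0 ≤ x.μ v ∧ x.μ v ≤ 1
  separation : ∀ v ∈ P.target, P.source ∉ P.inter → v ∉ P.inter → 1 ≤ x.μ P.source - x.μ v
  partition : ∀ e ∈ P.net.edges, e.1 ∉ P.inter → e.2 ∉ P.inter →
    0 ≤ x.d e - x.μ e.1 + x.μ e.2
  sysFlow : env ≠ .static → ∀ q, ∀ u ∈ P.sysSources (P.firstObs q),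
    (P.sysNet u).IsFlow (x.fsys q u)
  sysCut : env ≠ .static → ∀ q, ∀ u ∈ P.sysSources (P.firstObs q),
    ∀ e ∈ P.net.edges, e.1.2 = q → ∀ e' ∈ (P.sysNet u).edges,
      e'.1.1 = e.1.1 → e'.2.1 = e.2.1 → x.d e + x.fsys q u e' ≤ 1
  sysValue : env ≠ .static → ∀ q, ∀ u ∈ P.sysSources (P.firstObs q),
    1 ≤ (P.sysNet u).value (x.fsys q u)
  static_cuts : ∀ e ∈ P.net.edges, ∀ e' ∈ P.net.edges,
    e.1.1 = e'.1.1 → e.2.1 = e'.2.1 → (e.1.1, e.2.1) ∈ env.staticArea → x.d e = x.d e'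

/-- The objective: flow value minus the weighted number of cuts. -/
def objective (x : P.MILPPoint) : ℝ :=
  P.net.value x.f - 1 / (P.net.edges.card : ℝ) * ∑ e ∈ P.net.edges, x.d e

/-- Optimal solutions of the MILP. -/
def IsOptimal (env : TestEnv S) (x : P.MILPPoint) : Prop :=
  P.MILPFeasible env x ∧ ∀ y, P.MILPFeasible env y → P.objective y ≤ P.objective x

/-- The problem data are consistent: a flow value of at least one can be found. -/
def Consistent (env : TestEnv S) : Prop :=
  ∃ x, P.MILPFeasible env x ∧ 1 ≤ P.net.value x.f

/-- The reactive map: system transitions that are cut at the history variable `q`. -/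
def cutMap (d : P.Node × P.Node → ℝ) (q : P.Bπ.Q) : Set (S × S) :=
  {t | ∃ e ∈ P.net.edges, d e = 1 ∧ e.1 = (t.1, q) ∧ e.2.1 = t.2}

/-- The test strategy read off from the cuts: after a prefix with last state `s` and history
variable `q`, the actions that cause a transition of the reactive map at `q` are restricted. -/
def testStrategy (d : P.Node × P.Node → ℝ) (l : List S) : Set A :=
  {a | ∃ s s', l.getLast? = some s ∧ P.T.δ s a = some s' ∧ (s, s') ∈ P.cutMap d (P.hist l)}

end TestProblem

end TestSynth

end

/-! The proof translates in both directions between points of the MILP and feasible test strategies,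
and then compares optimal values.

Reduction to reachability. A run that satisfies the system objective reaches a terminal state, so
its word is eventually constant. The automata ignore repeated letters, hence satisfaction of either
objective is read off from the history at the terminal state (`IsRun.satisfies_iff`). Reachable
target nodes lie over terminal states, so executions of correct strategies correspond to walks in
`G` from the source to the target along unrestricted steps.

From cuts to strategies. Let a feasible point have flow value F > 0. An edge that carries flow is
uncut, because cuts are binary and `d + f ≤ 1`. A real flow contains ⌈F⌉ edge-disjoint source-target
walks (`IsFlow.exists_disjoint_walks`, by Hall's theorem), which become ⌈F⌉ unique traces. The
potential cannot drop along uncut edges outside the intermediate nodes, so every allowed walk to the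
target meets an intermediate node. The system flows, or the static constraints, provide the paths
required of the obstacles (`leavesPath_cutObstacles`).

From strategies to cuts. Let a feasible strategy have n unique traces. These are edge-disjoint and
carry a flow of value n. Cut the edges under obstacles, except edges under non-static obstacles that
one of the n traces uses, and let the potential be the indicator of the nodes reached over uncut
edges without leaving an intermediate node. The essential point is `BypassReach.notMem_target`: such
a node is never a target.

Comparison. The penalty of a point with positive flow lies in [0, 1), so an optimal point has F > n
- 1 whenever a feasible strategy has n ≥ 1 unique traces, and then ⌈F⌉ ≥ n. An optimum exists
because flows can be replaced by integral ones, after which the objective takes finitely many values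
(`exists_isOptimal`). -/

namespace TestSynth

universe u v w

/-! ### Automata runs and idempotent letters. -/

namespace DBA

variable {Ω : Type w}

/-- The state after reading the letters at the positions `0, …, k` of an infinite word. -/
def stateAt (B : DBA Ω) (ω : ℕ → Ω) : ℕ → B.Q
  | 0 => B.step B.init (ω 0)
  | k + 1 => B.step (stateAt B ω k) (ω (k + 1))

theorem stateAt_prod (B₁ B₂ : DBA Ω) (ω : ℕ → Ω) (k : ℕ) :
    (B₁.prod B₂).stateAt ω k = (B₁.stateAt ω k, B₂.stateAt ω k) := by
  induction k with
  | zero => rfl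
  | succ k ih => simp [stateAt, ih]

theorem run_map_range (B : DBA Ω) (ω : ℕ → Ω) (k : ℕ) :
    B.run ((List.range (k + 1)).map ω) = B.stateAt ω k := by
  induction k with
  | zero => rfl
  | succ k ih =>
    rw [List.range_succ, List.map_append, run, List.foldl_append]
    rw [run] at ih
    rw [ih]
    rfl

/-- Reading a letter twice in a row has the same effect as reading it once. -/
def IsIdempotent (B : DBA Ω) : Prop := ∀ q a, B.step (B.step q a) a = B.step q a

theorem IsIdempotent.step_stateAt {B : DBA Ω} (h : B.IsIdempotent) (ω : ℕ → Ω) (k : ℕ) :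
    B.step (B.stateAt ω k) (ω k) = B.stateAt ω k := by
  cases k <;> exact h _ _

theorem IsIdempotent.stateAt_const {B : DBA Ω} (h : B.IsIdempotent) {ω : ℕ → Ω} {k : ℕ}
    (hω : ∀ j, k ≤ j → ω j = ω k) {j : ℕ} (hj : k ≤ j) : B.stateAt ω j = B.stateAt ω k := by
  induction j, hj using Nat.le_induction with
  | base => rfl
  | succ j hj ih => rw [stateAt, ih, hω (j + 1) (by omega), h.step_stateAt]

theorem IsIdempotent.prod {B₁ B₂ : DBA Ω} (h₁ : B₁.IsIdempotent) (h₂ : B₂.IsIdempotent) :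
    (B₁.prod B₂).IsIdempotent := fun q a => Prod.ext (h₁ q.1 a) (h₂ q.2 a)

end DBA

/-! ### Progress of a sequenced visit on one letter. -/

section SeqBump

variable {AP : Type w} {m : ℕ} (p : Fin (m + 1) → AP) (a : Set AP)

theorem seqBump_eq_or (k : Fin (m + 2)) :
    seqBump p a k = k ∨
      ∃ h : (k : ℕ) < m + 1, p ⟨k, h⟩ ∈ a ∧ ((seqBump p a k : Fin (m + 2)) : ℕ) = k + 1 := by
  unfold seqBump
  split_ifs with h₁ h₂
  · exact Or.inr ⟨h₁, h₂, rfl⟩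
  · exact Or.inl rfl
  · exact Or.inl rfl

/-- Every bump that is not a fixed point raises the progress by one. As progress is at most `m + 1`,
this makes `m + 1` bumps enough to saturate a letter, which yields idempotence. -/
theorem seqBump_iterate_fixed_or_le (k : Fin (m + 2)) (n : ℕ) :
    seqBump p a ((seqBump p a)^[n] k) = (seqBump p a)^[n] k ∨
      n ≤ (((seqBump p a)^[n] k : Fin (m + 2)) : ℕ) := by
  induction n with
  | zero => exact Or.inr (Nat.zero_le _)
  | succ n ih =>
    rw [Function.iterate_succ_apply']
    rcases ih with ih | ih
    · rw [ih, ih]; exact Or.inl rfl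
    · rcases seqBump_eq_or p a ((seqBump p a)^[n] k) with h | ⟨_, _, h⟩
      · rw [h, h]; exact Or.inl rfl
      · right; rw [h]; omega

theorem seqBump_iterate_fixed (k : Fin (m + 2)) :
    seqBump p a ((seqBump p a)^[m + 1] k) = (seqBump p a)^[m + 1] k := by
  rcases seqBump_iterate_fixed_or_le p a k (m + 1) with h | h
  · exact h
  · rcases seqBump_eq_or p a ((seqBump p a)^[m + 1] k) with h' | ⟨h', _⟩
    · exact h'
    · omega

theorem mem_of_seqBump_iterate_eq_last (k : Fin (m + 2)) (n : ℕ)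
    (h : (seqBump p a)^[n] k = Fin.last (m + 1)) : k = Fin.last (m + 1) ∨ p (Fin.last m) ∈ a := by
  induction n with
  | zero => exact Or.inl h
  | succ n ih =>
    rw [Function.iterate_succ_apply'] at h
    rcases seqBump_eq_or p a ((seqBump p a)^[n] k) with h' | ⟨h₁, h₂, h₃⟩
    · exact ih (h' ▸ h)
    · right
      rw [h, Fin.val_last] at h₃
      convert h₂ using 2
      ext
      simp only [Fin.val_last]
      omega

end SeqBump

/-! ### LTL semantics of sub-tasks versus their automata on eventually constant words. -/

section Subtask

variable {AP : Type w}

theorem isIdempotent_subtaskBA (t : Subtask AP) : (subtaskBA t).IsIdempotent := by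
  intro q a
  cases t with
  | visit m p => exact (Set.union_assoc _ _ _).trans (congrArg _ (Set.union_self _))
  | seqVisit m p => exact Function.iterate_fixed (seqBump_iterate_fixed p a q) (m + 1)
  | safety p => exact (Bool.and_assoc _ _ _).trans (congrArg _ (Bool.and_self _))
  | instantReaction p r => exact (Bool.and_assoc _ _ _).trans (congrArg _ (Bool.and_self _))
  | delayedReaction p r =>
    simp only [subtaskBA]
    cases q <;> cases decide (p ∈ a) <;> cases decide (r ∉ a) <;> rfl

theorem isIdempotent_objectiveBA (φ : Objective AP) : (objectiveBA φ).IsIdempotent := by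
  induction φ with
  | nil => exact fun _ _ => rfl
  | cons t φ ih => exact (isIdempotent_subtaskBA t).prod ih

variable {ω : ℕ → Set AP}

namespace LTL

theorem holdsAt_ev {φ : LTL AP} {i : ℕ} : HoldsAt ω φ.ev i ↔ ∃ k, i ≤ k ∧ HoldsAt ω φ k := by
  simp [ev, HoldsAt]

theorem holdsAt_alw {φ : LTL AP} {i : ℕ} : HoldsAt ω φ.alw i ↔ ∀ k, i ≤ k → HoldsAt ω φ k := by
  simp [alw, ev, HoldsAt]

theorem holdsAt_imp {φ ψ : LTL AP} {i : ℕ} :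
    HoldsAt ω (φ.imp ψ) i ↔ (HoldsAt ω φ i → HoldsAt ω ψ i) := by
  simp [imp, HoldsAt]

theorem holdsAt_bigConj {l : List (LTL AP)} {i : ℕ} :
    HoldsAt ω (bigConj l) i ↔ ∀ φ ∈ l, HoldsAt ω φ i := by
  induction l with
  | nil => simp [bigConj, HoldsAt]
  | cons φ l ih => simp [bigConj, HoldsAt, ih]

theorem holdsAt_sequenced_cons {p : AP} {l : List AP} {i : ℕ} :
    HoldsAt ω (sequenced (p :: l)) i ↔ ∃ k, i ≤ k ∧ p ∈ ω k ∧ HoldsAt ω (sequenced l) k := by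
  cases l with
  | nil => simp [sequenced, holdsAt_ev, HoldsAt]
  | cons q l => rw [sequenced, holdsAt_ev]; rfl

theorem holdsAt_sequenced_mono {l : List AP} {i j : ℕ} (hij : i ≤ j)
    (h : HoldsAt ω (sequenced l) j) : HoldsAt ω (sequenced l) i := by
  cases l with
  | nil => exact True.intro
  | cons p l =>
    rw [holdsAt_sequenced_cons] at h ⊢
    obtain ⟨k, hk, h⟩ := h
    exact ⟨k, hij.trans hk, h⟩

theorem exists_mem_of_holdsAt_sequenced {l : List AP} {i : ℕ} (h : HoldsAt ω (sequenced l) i)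
    {p : AP} (hp : p ∈ l) : ∃ k, p ∈ ω k := by
  induction l generalizing i with
  | nil => simp at hp
  | cons q l ih =>
    obtain ⟨k, _, hk, h⟩ := holdsAt_sequenced_cons.1 h
    rcases List.mem_cons.1 hp with rfl | hp
    · exact ⟨k, hk⟩
    · exact ih h hp

end LTL

open LTL

section SeqVisit

variable {m : ℕ} (p : Fin (m + 1) → AP)

/-- The propositions from index `c` on remain to be visited in order, starting at position `i`. -/
def Remaining (ω : ℕ → Set AP) (c i : ℕ) : Prop := HoldsAt ω (sequenced ((List.ofFn p).drop c)) i

theorem remaining_of_lt {c i : ℕ} (hc : c < m + 1) :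
    Remaining p ω c i ↔ ∃ k, i ≤ k ∧ p ⟨c, hc⟩ ∈ ω k ∧ Remaining p ω (c + 1) k := by
  unfold Remaining
  rw [List.drop_eq_getElem_cons (by simpa using hc), holdsAt_sequenced_cons, List.getElem_ofFn]

theorem remaining_last {i : ℕ} : Remaining p ω (m + 1) i := by
  unfold Remaining
  rw [List.drop_eq_nil_of_le (by simp)]
  exact True.intro

/-- Visiting a proposition at the earliest opportunity loses nothing, because the visits that remain
after a later position also remain possible from an earlier one. -/
theorem remaining_seqBump (c : Fin (m + 2)) (i : ℕ) :
    Remaining p ω (seqBump p (ω i) c : Fin (m + 2)) i ↔ Remaining p ω c i := by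
  rcases seqBump_eq_or p (ω i) c with h | ⟨hc, hp, h⟩
  · rw [h]
  · rw [h, remaining_of_lt p hc]
    exact ⟨fun h => ⟨i, le_rfl, hp, h⟩, fun ⟨k, hk, _, h⟩ => holdsAt_sequenced_mono hk h⟩

theorem remaining_seqBump_iterate (c : Fin (m + 2)) (i n : ℕ) :
    Remaining p ω ((seqBump p (ω i))^[n] c : Fin (m + 2)) i ↔ Remaining p ω c i := by
  induction n with
  | zero => rfl
  | succ n ih => rw [Function.iterate_succ_apply', remaining_seqBump, ih]

theorem eq_last_or_notMem_of_seqBump_eq {a : Set AP} {c : Fin (m + 2)} (h : seqBump p a c = c) :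
    (c : ℕ) = m + 1 ∨ ∃ hc : (c : ℕ) < m + 1, p ⟨c, hc⟩ ∉ a := by
  by_cases hc : (c : ℕ) < m + 1
  · refine Or.inr ⟨hc, fun hp => ?_⟩
    have := congrArg Fin.val h
    simp [seqBump, hc, hp] at this
  · left; omega

/-- At a saturated progress the next proposition is absent from the current letter, so it can only
be visited strictly later. -/
theorem remaining_succ {c : Fin (m + 2)} {i : ℕ} (h : seqBump p (ω i) c = c) :
    Remaining p ω c (i + 1) ↔ Remaining p ω c i := by
  rcases eq_last_or_notMem_of_seqBump_eq p h with hc | ⟨hc, hp⟩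
  · rw [hc]; exact iff_of_true (remaining_last p) (remaining_last p)
  · refine ⟨fun h => holdsAt_sequenced_mono (Nat.le_succ i) h, fun h => ?_⟩
    rw [remaining_of_lt p hc] at h ⊢
    obtain ⟨k, hk, h₁, h₂⟩ := h
    refine ⟨k, ?_, h₁, h₂⟩
    rcases hk.eq_or_lt with rfl | hk
    · exact absurd h₁ hp
    · exact hk

/-- Loop invariant of the automaton: the truth of the whole formula is that of the part left over
after the letters read so far. -/
theorem remaining_stateAt (k : ℕ) :
    Remaining p ω (Fin.val (n := m + 2) ((subtaskBA (.seqVisit m p)).stateAt ω k)) (k + 1) ↔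
      Remaining p ω 0 0 := by
  induction k with
  | zero =>
    refine (remaining_succ p (seqBump_iterate_fixed p _ _)).trans ?_
    exact remaining_seqBump_iterate p (0 : Fin (m + 2)) 0 (m + 1)
  | succ k ih =>
    rw [← ih]
    refine (remaining_succ p (seqBump_iterate_fixed p _ _)).trans ?_
    exact remaining_seqBump_iterate p _ (k + 1) (m + 1)

theorem seqBump_stateAt (k : ℕ) :
    seqBump p (ω k) ((subtaskBA (.seqVisit m p)).stateAt ω k) =
      (subtaskBA (.seqVisit m p)).stateAt ω k := by
  cases k <;> exact seqBump_iterate_fixed p _ _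

end SeqVisit

theorem mem_stateAt_visit {m : ℕ} (p : Fin (m + 1) → AP) (k : ℕ) (i : Fin (m + 1)) :
    i ∈ (show Set (Fin (m + 1)) from (subtaskBA (.visit m p)).stateAt ω k) ↔
      ∃ j ≤ k, p i ∈ ω j := by
  induction k with
  | zero => simp [DBA.stateAt, subtaskBA]
  | succ k ih =>
    change i ∈ (show Set (Fin (m + 1)) from (subtaskBA (.visit m p)).stateAt ω k) ∪
      {i | p i ∈ ω (k + 1)} ↔ _
    rw [Set.mem_union, ih]
    simp only [Set.mem_ofPred_eq, Nat.le_succ_iff]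
    constructor
    · rintro (⟨j, hj, h⟩ | h)
      · exact ⟨j, Or.inl hj, h⟩
      · exact ⟨_, Or.inr rfl, h⟩
    · rintro ⟨j, hj | rfl, h⟩
      · exact Or.inl ⟨j, hj, h⟩
      · exact Or.inr h

theorem stateAt_safety (p : AP) (k : ℕ) :
    (subtaskBA (.safety p)).stateAt ω k = true ↔ ∀ j ≤ k, p ∉ ω j := by
  induction k with
  | zero => simp only [DBA.stateAt, subtaskBA, Bool.true_and, decide_eq_true_iff,
      Nat.le_zero, forall_eq]
  | succ k ih =>
    refine (Bool.and_eq_true_iff.trans (and_congr ih decide_eq_true_iff)).trans ?_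
    simp only [Nat.le_succ_iff, or_imp, forall_and, forall_eq]

theorem stateAt_instantReaction (p r : AP) (k : ℕ) :
    (subtaskBA (.instantReaction p r)).stateAt ω k = true ↔ ∀ j ≤ k, p ∈ ω j → r ∈ ω j := by
  induction k with
  | zero => simp only [DBA.stateAt, subtaskBA, Bool.true_and, decide_eq_true_iff,
      Nat.le_zero, forall_eq]
  | succ k ih =>
    refine (Bool.and_eq_true_iff.trans (and_congr ih decide_eq_true_iff)).trans ?_
    simp only [Nat.le_succ_iff, or_imp, forall_and, forall_eq]

theorem stateAt_delayedReaction (p r : AP) (k : ℕ) :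
    (subtaskBA (.delayedReaction p r)).stateAt ω k = true ↔
      ∃ i ≤ k, p ∈ ω i ∧ ∀ j, i ≤ j → j ≤ k → r ∉ ω j := by
  induction k with
  | zero =>
    simp only [DBA.stateAt, subtaskBA, Bool.false_or, Bool.and_eq_true, decide_eq_true_iff]
    constructor
    · rintro ⟨h₁, h₂⟩
      exact ⟨0, le_rfl, h₁, fun j _ hj => by rwa [Nat.le_zero.1 hj]⟩
    · rintro ⟨i, hi, h₁, h₂⟩
      obtain rfl := Nat.le_zero.1 hi
      exact ⟨h₁, h₂ 0 le_rfl le_rfl⟩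
  | succ k ih =>
    refine (Bool.and_eq_true_iff.trans (and_congr (Bool.or_eq_true_iff.trans
      (or_congr ih decide_eq_true_iff)) decide_eq_true_iff)).trans ?_
    constructor
    · rintro ⟨⟨i, hi, h₁, h₂⟩ | h₁, h₃⟩
      · refine ⟨i, by omega, h₁, fun j hij hj => ?_⟩
        rcases Nat.le_succ_iff.1 hj with hj | rfl
        · exact h₂ j hij hj
        · exact h₃
      · refine ⟨k + 1, le_rfl, h₁, fun j hij hj => ?_⟩
        rwa [le_antisymm hj hij]
    · rintro ⟨i, hi, h₁, h₂⟩
      refine ⟨?_, h₂ _ hi le_rfl⟩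
      rcases Nat.le_succ_iff.1 hi with hi | rfl
      · exact Or.inl ⟨i, hi, h₁, fun j hij hj => h₂ j hij (by omega)⟩
      · exact Or.inr h₁

/-- On a word that is constant from position `k` on, a sub-task holds iff its automaton is in an
accepting state after position `k`. -/
theorem sat_subtask_iff (t : Subtask AP) {k : ℕ} (hω : ∀ j, k ≤ j → ω j = ω k) :
    Sat ω t.formula ↔ (subtaskBA t).stateAt ω k ∈ (subtaskBA t).acc := by
  cases t with
  | visit m p =>
    have h : (subtaskBA (.visit m p)).stateAt ω k ∈ (subtaskBA (.visit m p)).acc ↔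
        ∀ i, ∃ j ≤ k, p i ∈ ω j := by
      refine Iff.trans (b := (show Set (Fin (m + 1)) from
        (subtaskBA (.visit m p)).stateAt ω k) = Set.univ) Iff.rfl ?_
      rw [Set.eq_univ_iff_forall]
      exact forall_congr' (mem_stateAt_visit p k)
    rw [h]
    simp only [Sat, Subtask.formula, holdsAt_bigConj, List.forall_mem_ofFn_iff, holdsAt_ev,
      Nat.zero_le, true_and]
    refine forall_congr' fun i => ⟨?_, fun ⟨j, _, h⟩ => ⟨j, h⟩⟩
    rintro ⟨j, hj⟩
    rcases le_total j k with h | h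
    · exact ⟨j, h, hj⟩
    · exact ⟨k, le_rfl, by rw [← hω j h]; exact hj⟩
  | seqVisit m p =>
    refine Iff.trans (b := Remaining p ω 0 0) Iff.rfl ?_
    rw [← remaining_stateAt p k]
    have hfix := seqBump_stateAt (ω := ω) p k
    constructor
    · intro h
      -- The next proposition of an unfinished saturated progress is missing from `ω k`, hence from
      -- the whole constant tail.
      rcases eq_last_or_notMem_of_seqBump_eq p hfix with hc | ⟨hc, hp⟩
      · exact Fin.ext hc
      · obtain ⟨j, hj, h₁, _⟩ := (remaining_of_lt p hc).1 h
        rw [hω j (by omega)] at h₁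
        exact absurd h₁ hp
    · intro h
      have h' : (subtaskBA (.seqVisit m p)).stateAt ω k = Fin.last (m + 1) := h
      rw [h']
      exact remaining_last p
  | safety p =>
    refine Iff.trans ?_ (stateAt_safety p k).symm
    simp only [Sat, Subtask.formula, holdsAt_alw, Nat.zero_le, true_imp_iff]
    refine ⟨fun h j _ => h j, fun h j => ?_⟩
    rcases le_total j k with hj | hj
    · exact h j hj
    · change p ∉ ω j
      rw [hω j hj]; exact h k le_rfl
  | instantReaction p r =>
    refine Iff.trans ?_ (stateAt_instantReaction p r k).symm
    simp only [Sat, Subtask.formula, holdsAt_alw, holdsAt_imp, Nat.zero_le, true_imp_iff]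
    refine ⟨fun h j _ => h j, fun h j => ?_⟩
    rcases le_total j k with hj | hj
    · exact h j hj
    · change p ∈ ω j → r ∈ ω j
      rw [hω j hj]; exact h k le_rfl
  | delayedReaction p r =>
    have h : (subtaskBA (.delayedReaction p r)).stateAt ω k ∈
        (subtaskBA (.delayedReaction p r)).acc ↔
        ¬ (subtaskBA (.delayedReaction p r)).stateAt ω k = true :=
      (Bool.not_eq_true _).symm.to_iff
    rw [h, stateAt_delayedReaction]
    simp only [Sat, Subtask.formula, holdsAt_alw, holdsAt_imp, holdsAt_ev, Nat.zero_le,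
      true_imp_iff, HoldsAt]
    push Not
    constructor
    · intro h i hi hp
      obtain ⟨j, hij, hj⟩ := h i hp
      rcases le_total j k with hjk | hjk
      · exact ⟨j, hij, hjk, hj⟩
      · exact ⟨k, hi, le_rfl, by rwa [← hω j hjk]⟩
    · intro h i hp
      rcases le_total i k with hik | hik
      · obtain ⟨j, hij, _, hj⟩ := h i hik hp
        exact ⟨j, hij, hj⟩
      -- A request in the constant tail is already a request at `k`; its response at `k` recurs at
      -- `i`.
      · rw [hω i hik] at hp
        obtain ⟨j, hkj, hjk, hj⟩ := h k le_rfl hp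
        obtain rfl := le_antisymm hjk hkj
        exact ⟨i, le_rfl, by rwa [hω i hik]⟩

theorem sat_objective_iff (φ : Objective AP) {k : ℕ} (hω : ∀ j, k ≤ j → ω j = ω k) :
    Sat ω φ.formula ↔ (objectiveBA φ).stateAt ω k ∈ (objectiveBA φ).acc := by
  induction φ with
  | nil => exact iff_of_true True.intro (Set.mem_univ _)
  | cons t φ ih =>
    rw [objectiveBA, DBA.stateAt_prod]
    exact and_congr (sat_subtask_iff t hω) ih

/-- A satisfied visit or sequenced visit sub-task sees its final proposition. -/
theorem exists_mem_of_sat_of_finalProp {t : Subtask AP} {p : AP} (ht : t.finalProp = some p)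
    (h : Sat ω t.formula) : ∃ k, p ∈ ω k := by
  cases t with
  | visit m r =>
    obtain rfl : r (Fin.last m) = p := Option.some.inj ht
    simp only [Sat, Subtask.formula, holdsAt_bigConj, List.forall_mem_ofFn_iff, holdsAt_ev,
      Nat.zero_le, true_and] at h
    exact h _
  | seqVisit m r =>
    obtain rfl : r (Fin.last m) = p := Option.some.inj ht
    exact exists_mem_of_holdsAt_sequenced h (List.mem_ofFn.2 ⟨_, rfl⟩)
  | safety _ => simp [Subtask.finalProp] at ht
  | instantReaction _ _ => simp [Subtask.finalProp] at ht
  | delayedReaction _ _ => simp [Subtask.finalProp] at ht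

theorem exists_mem_of_stateAt_mem_acc {t : Subtask AP} {p : AP} (ht : t.finalProp = some p)
    {k : ℕ} (h : (subtaskBA t).stateAt ω k ∈ (subtaskBA t).acc) : ∃ j ≤ k, p ∈ ω j := by
  cases t with
  | visit m r =>
    obtain rfl : r (Fin.last m) = p := Option.some.inj ht
    have h' : (show Set (Fin (m + 1)) from (subtaskBA (.visit m r)).stateAt ω k) = Set.univ := h
    exact (mem_stateAt_visit r k _).1 (h' ▸ Set.mem_univ _)
  | seqVisit m r =>
    obtain rfl : r (Fin.last m) = p := Option.some.inj ht
    induction k with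
    | zero =>
      rcases mem_of_seqBump_iterate_eq_last r (ω 0) 0 (m + 1) h with h | h
      · exact absurd (congrArg Fin.val h) (by simp)
      · exact ⟨0, le_rfl, h⟩
    | succ k ih =>
      rcases mem_of_seqBump_iterate_eq_last r (ω (k + 1)) _ (m + 1) h with h | h
      · obtain ⟨j, hj, hp⟩ := ih h
        exact ⟨j, by omega, hp⟩
      · exact ⟨k + 1, le_rfl, h⟩
  | safety _ => simp [Subtask.finalProp] at ht
  | instantReaction _ _ => simp [Subtask.finalProp] at ht
  | delayedReaction _ _ => simp [Subtask.finalProp] at ht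

theorem stateAt_mem_acc_of_mem {φ : Objective AP} {t : Subtask AP} (ht : t ∈ φ) {k : ℕ}
    (h : (objectiveBA φ).stateAt ω k ∈ (objectiveBA φ).acc) :
    (subtaskBA t).stateAt ω k ∈ (subtaskBA t).acc := by
  induction φ with
  | nil => simp at ht
  | cons r φ ih =>
    rw [objectiveBA, DBA.stateAt_prod] at h
    rcases List.mem_cons.1 ht with rfl | ht
    · exact h.1
    · exact ih ht h.2

theorem sat_of_mem {φ : Objective AP} {t : Subtask AP} (ht : t ∈ φ) (h : Sat ω φ.formula) :
    Sat ω t.formula :=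
  holdsAt_bigConj.1 h _ (List.mem_map_of_mem ht)

theorem step_mem_acc_of_isReach {t : Subtask AP} (ht : t.IsReach) {q : (subtaskBA t).Q}
    (hq : q ∈ (subtaskBA t).acc) (a : Set AP) : (subtaskBA t).step q a ∈ (subtaskBA t).acc := by
  cases t with
  | visit m p =>
    have hq' : q = (Set.univ : Set (Fin (m + 1))) := hq
    subst hq'
    exact Set.univ_union _
  | seqVisit m p =>
    have hq' : q = Fin.last (m + 1) := hq
    subst hq'
    exact Function.iterate_fixed (by simp [seqBump]) (m + 1)
  | safety _ => exact ht.elim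
  | instantReaction _ _ => exact ht.elim
  | delayedReaction _ _ => exact ht.elim

/-- A conjunction of visits and sequenced visits remains accomplished. -/
theorem step_mem_acc_of_forall_isReach {φ : Objective AP} (hφ : ∀ t ∈ φ, t.IsReach)
    {q : (objectiveBA φ).Q} (hq : q ∈ (objectiveBA φ).acc) (a : Set AP) :
    (objectiveBA φ).step q a ∈ (objectiveBA φ).acc := by
  induction φ with
  | nil => exact Set.mem_univ _
  | cons t φ ih =>
    exact ⟨step_mem_acc_of_isReach (hφ t List.mem_cons_self) hq.1 a,
      ih (fun r hr => hφ r (List.mem_cons_of_mem _ hr)) hq.2⟩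

end Subtask

end TestSynth

namespace TestSynth

universe u

/-! ### Walks and shortest walks. -/

section SimplePaths

variable {V : Type u}

theorem reflTransGen_of_walk {r : V → V → Prop} {w : ℕ → V} {m : ℕ}
    (hw : ∀ k < m, r (w k) (w (k + 1))) {k : ℕ} (hk : k ≤ m) :
    Relation.ReflTransGen r (w 0) (w k) := by
  induction k with
  | zero => exact .refl
  | succ k ih => exact (ih (by omega)).tail (hw k (by omega))

theorem exists_walk_of_reflTransGen {r : V → V → Prop} {x y : V}
    (h : Relation.ReflTransGen r x y) :
    ∃ (m : ℕ) (w : ℕ → V), w 0 = x ∧ w m = y ∧ ∀ k < m, r (w k) (w (k + 1)) := by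
  induction h with
  | refl => exact ⟨0, fun _ => x, rfl, rfl, by simp⟩
  | @tail y z _ hyz ih =>
    obtain ⟨m, w, h0, hm, hw⟩ := ih
    refine ⟨m + 1, fun k => if k ≤ m then w k else z, by simp [h0], by simp, fun k hk => ?_⟩
    rcases Nat.lt_succ_iff_lt_or_eq.1 hk with hk | rfl
    · simpa [hk.le, Nat.succ_le_of_lt hk] using hw k hk
    · simpa [hm] using hyz

/-- A shortest walk into a set visits no vertex twice, and meets the set only at its end. -/
theorem exists_simple_walk {r : V → V → Prop} {x : V} {Y : Set V}
    (h : ∃ y ∈ Y, Relation.ReflTransGen r x y) :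
    ∃ (m : ℕ) (w : ℕ → V), w 0 = x ∧ w m ∈ Y ∧ (∀ k < m, r (w k) (w (k + 1))) ∧
      (∀ j k, j < k → k ≤ m → w j ≠ w k) ∧ ∀ k < m, w k ∉ Y := by
  have hex : ∃ (m : ℕ) (w : ℕ → V), w 0 = x ∧ w m ∈ Y ∧ ∀ k < m, r (w k) (w (k + 1)) := by
    obtain ⟨y, hy, h⟩ := h
    obtain ⟨m, w, h0, hm, hw⟩ := exists_walk_of_reflTransGen h
    exact ⟨m, w, h0, hm ▸ hy, hw⟩
  obtain ⟨w, h0, hm, hw⟩ := Nat.find_spec hex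
  have hmin := fun k (hk : k < Nat.find hex) => Nat.find_min hex hk
  generalize Nat.find hex = m at hm hw hmin
  refine ⟨m, w, h0, hm, hw, fun j k hjk hk heq => ?_, fun k hk hY => ?_⟩
  -- A repeated vertex allows the loop between `j` and `k` to be cut out, which contradicts
  -- minimality.
  · refine hmin (m - (k - j)) (by omega)
      ⟨fun i => if i ≤ j then w i else w (i + (k - j)), by simp [h0], ?_, fun i hi => ?_⟩
    · dsimp only
      split_ifs with hle
      · have hkm : k = m := by omega
        have : m - (k - j) = j := by omega
        rw [this, heq, hkm]; exact hm
      · rwa [Nat.sub_add_cancel (by omega)]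
    · dsimp only
      rcases lt_trichotomy i j with hij | rfl | hij
      · rw [if_pos hij.le, if_pos (by omega)]; exact hw i (by omega)
      · rw [if_pos le_rfl, if_neg (by omega), heq]
        have : i + 1 + (k - i) = k + 1 := by omega
        rw [this]; exact hw k (by omega)
      · rw [if_neg (by omega), if_neg (by omega)]
        have : i + 1 + (k - j) = i + (k - j) + 1 := by omega
        rw [this]; exact hw _ (by omega)
  · exact hmin k hk ⟨w, h0, hY, fun i hi => hw i (by omega)⟩

end SimplePaths

/-! ### Flows carried by edge-disjoint walks. -/

namespace FlowNetwork

variable {V : Type u}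

/-- The number of times that a walk of length `m` uses an edge. -/
noncomputable def walkFlow (w : ℕ → V) (m : ℕ) (e : V × V) : ℝ :=
  ∑ k ∈ Finset.range m, if e = (w k, w (k + 1)) then 1 else 0

theorem walkFlow_nonneg (w : ℕ → V) (m : ℕ) (e : V × V) : 0 ≤ walkFlow w m e :=
  Finset.sum_nonneg fun _ _ => by split_ifs <;> norm_num

theorem exists_of_walkFlow_ne_zero {w : ℕ → V} {m : ℕ} {e : V × V} (h : walkFlow w m e ≠ 0) :
    ∃ k < m, e = (w k, w (k + 1)) := by
  obtain ⟨k, hk, h⟩ := Finset.exists_ne_zero_of_sum_ne_zero h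
  exact ⟨k, Finset.mem_range.1 hk, by by_contra hne; simp [hne] at h⟩

theorem walkFlow_le_one {w : ℕ → V} {m : ℕ} (hw : ∀ j k, j < k → k ≤ m → w j ≠ w k)
    (e : V × V) : walkFlow w m e ≤ 1 := by
  by_cases h : ∃ k < m, e = (w k, w (k + 1))
  · obtain ⟨k, hk, rfl⟩ := h
    rw [walkFlow, Finset.sum_eq_single_of_mem k (Finset.mem_range.2 hk)]
    · simp
    · intro j hj hjk
      rw [if_neg]
      intro heq
      have h1 : w k = w j := congrArg Prod.fst heq
      have := Finset.mem_range.1 hj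
      rcases lt_or_gt_of_ne hjk with h | h
      · exact hw j k h hk.le h1.symm
      · exact hw k j h this.le h1
  · have : walkFlow w m e = 0 := by
      by_contra hne
      exact h (exists_of_walkFlow_ne_zero hne)
    rw [this]; exact zero_le_one

theorem sum_le_sum_of_support_subset {g : V × V → ℝ} (h0 : ∀ e, 0 ≤ g e) {s t : Finset (V × V)}
    (h : ∀ e ∈ s, g e ≠ 0 → e ∈ t) : ∑ e ∈ s, g e ≤ ∑ e ∈ t, g e := by
  rw [← Finset.sum_filter_ne_zero]
  refine Finset.sum_le_sum_of_subset_of_nonneg (fun e he => ?_) fun e _ _ => h0 e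
  exact h e (Finset.mem_filter.1 he).1 (Finset.mem_filter.1 he).2

variable [Fintype V] {N : FlowNetwork V}

theorem mem_edges {e : V × V} : e ∈ N.edges ↔ e ∈ N.E := by simp [edges]

theorem sum_walkFlow {w : ℕ → V} {m : ℕ} (hw : ∀ k < m, (w k, w (k + 1)) ∈ N.E)
    (p : V × V → Prop) :
    ∑ e ∈ N.edges with p e, walkFlow w m e =
      ∑ k ∈ Finset.range m, if p (w k, w (k + 1)) then 1 else 0 := by
  unfold walkFlow
  rw [Finset.sum_comm]
  refine Finset.sum_congr rfl fun k hk => ?_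
  rw [Finset.sum_ite_eq']
  simp [mem_edges, hw k (Finset.mem_range.1 hk)]

theorem isFlow_walkFlow {s : V} (hsrc : N.src = {s}) (hs : s ∉ N.snk) {w : ℕ → V} {m : ℕ}
    (h0 : w 0 = s) (hm : w m ∈ N.snk) (hw : ∀ k < m, (w k, w (k + 1)) ∈ N.E)
    (hne : ∀ j k, j < k → k ≤ m → w j ≠ w k) (hsnk : ∀ k < m, w k ∉ N.snk) :
    N.IsFlow (walkFlow w m) ∧ N.value (walkFlow w m) = 1 := by
  have hm0 : 0 < m := by
    rcases Nat.eq_zero_or_pos m with rfl | h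
    · exact absurd (h0 ▸ hm) hs
    · exact h
  refine ⟨⟨fun e _ => ⟨walkFlow_nonneg w m e, walkFlow_le_one hne e⟩, fun x hx hx' => ?_,
    fun e _ he => ?_⟩, ?_⟩
  · rw [sum_walkFlow hw, sum_walkFlow hw, ← sub_eq_zero, ← Finset.sum_sub_distrib]
    -- Inflow minus outflow at `x` telescopes along the walk, leaving only its two ends, neither of
    -- which is `x`.
    rw [Finset.sum_range_sub (fun k => if w k = x then (1 : ℝ) else 0)]
    have h1 : w m ≠ x := fun h => hx' (h ▸ hm)
    have h2 : w 0 ≠ x := fun h => hx (by rw [hsrc, ← h, h0]; rfl)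
    simp [h1, h2]
  · by_contra hne0
    obtain ⟨k, hk, rfl⟩ := exists_of_walkFlow_ne_zero hne0
    rcases he with he | he
    · exact hsnk k hk he
    · rw [hsrc] at he
      exact hne 0 (k + 1) (Nat.succ_pos k) hk (h0.trans (Eq.symm he))
  · rw [value, sum_walkFlow hw, Finset.sum_eq_single_of_mem 0 (Finset.mem_range.2 hm0)]
    · simp [hsrc, h0]
    · intro k hk hk0
      rw [if_neg]
      rw [hsrc]
      intro h
      exact hne 0 k (Nat.pos_of_ne_zero hk0) (Finset.mem_range.1 hk).le
        (h0.trans (Eq.symm h))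

/-- Edge-disjoint connections from the source to the sinks carry a flow. -/
theorem exists_flow_of_disjoint {ι : Type*} [Fintype ι] {s : V} (hsrc : N.src = {s})
    (hs : s ∉ N.snk) (r : ι → V → V → Prop) (hr : ∀ i x y, r i x y → x ≠ y → (x, y) ∈ N.E)
    (hdis : ∀ i j x y, r i x y → r j x y → x ≠ y → i = j)
    (hreach : ∀ i, ∃ t ∈ N.snk, Relation.ReflTransGen (r i) s t) :
    ∃ f, N.IsFlow f ∧ N.value f = Fintype.card ι ∧ ∀ e, f e ≠ 0 → ∃ i, r i e.1 e.2 := by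
  -- Simple walks use no self-loops, so `hr` and `hdis`, which only concern distinct endpoints,
  -- apply to each of their steps.
  choose m w h0 hm hw hne hsnk using fun i => exists_simple_walk (hreach i)
  have hE : ∀ i, ∀ k < m i, (w i k, w i (k + 1)) ∈ N.E := fun i k hk =>
    hr i _ _ (hw i k hk) (hne i _ _ (Nat.lt_succ_self k) hk)
  have hflow := fun i => isFlow_walkFlow hsrc hs (h0 i) (hm i) (hE i) (hne i) (hsnk i)
  have hzero : ∀ e i j, walkFlow (w i) (m i) e ≠ 0 → walkFlow (w j) (m j) e ≠ 0 → i = j := by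
    intro e i j hi hj
    obtain ⟨k, hk, rfl⟩ := exists_of_walkFlow_ne_zero hi
    obtain ⟨l, hl, heq⟩ := exists_of_walkFlow_ne_zero hj
    refine hdis i j _ _ (hw i k hk) ?_ (hne i _ _ (Nat.lt_succ_self k) hk)
    have h1 : w i k = w j l := congrArg Prod.fst heq
    have h2 : w i (k + 1) = w j (l + 1) := congrArg Prod.snd heq
    rw [h1, h2]
    exact hw j l hl
  refine ⟨fun e => ∑ i, walkFlow (w i) (m i) e, ⟨fun e he => ⟨?_, ?_⟩, fun x hx hx' => ?_,
    fun e he hb => ?_⟩, ?_, fun e he => ?_⟩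
  · exact Finset.sum_nonneg fun i _ => walkFlow_nonneg _ _ _
  · by_cases h : ∃ i, walkFlow (w i) (m i) e ≠ 0
    · obtain ⟨i, hi⟩ := h
      rw [Finset.sum_eq_single_of_mem i (Finset.mem_univ i)]
      · exact walkFlow_le_one (hne i) e
      · intro j _ hji
        by_contra hj
        exact hji (hzero e j i hj hi)
    · push Not at h
      rw [Finset.sum_eq_zero fun i _ => h i]
      exact zero_le_one
  · rw [Finset.sum_comm, Finset.sum_comm (s := N.edges.filter fun e => e.1 = x)]
    exact Finset.sum_congr rfl fun i _ => (hflow i).1.conservation x hx hx'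
  · exact Finset.sum_eq_zero fun i _ => (hflow i).1.boundary e he hb
  · rw [value, Finset.sum_comm]
    refine (Finset.sum_congr rfl fun i _ => (hflow i).2).trans ?_
    simp
  · obtain ⟨i, _, hi⟩ := Finset.exists_ne_zero_of_sum_ne_zero he
    obtain ⟨k, hk, rfl⟩ := exists_of_walkFlow_ne_zero hi
    exact ⟨i, hw i k hk⟩

/-! ### Decomposition of a real flow into edge-disjoint walks by Hall's theorem. -/

section Decomposition

/-- The successor relation on `n` tokens and all edges: a token is followed by an edge out of a
source, an edge by itself, by a consecutive edge, or by a token if it leads to a sink. Apart from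
the first alternative for edges, only edges that carry flow are used. -/
def Follows (N : FlowNetwork V) (g : V × V → ℝ) (n : ℕ) :
    Fin n ⊕ (V × V) → Fin n ⊕ (V × V) → Prop
  | .inl _, .inl _ => False
  | .inl _, .inr e => 0 < g e ∧ e.1 ∈ N.src
  | .inr e, .inl _ => 0 < g e ∧ e.2 ∈ N.snk
  | .inr e, .inr e' => e = e' ∨ 0 < g e ∧ 0 < g e' ∧ e.2 = e'.1

variable {g : V × V → ℝ} {n : ℕ}

theorem sum_sum_filter_eq (c : V × V → V) (s : Finset V) :
    ∑ x ∈ s, ∑ e with c e = x, g e = ∑ e with c e ∈ s, g e := by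
  simp only [Finset.sum_filter]
  rw [Finset.sum_comm]
  simp

theorem sum_snk_eq_sum_src
    (hcons : ∀ x, x ∉ N.src → x ∉ N.snk → ∑ e with e.2 = x, g e = ∑ e with e.1 = x, g e)
    (hsnk : ∀ e, e.1 ∈ N.snk → g e = 0) (hsrc : ∀ e, e.2 ∈ N.src → g e = 0) :
    ∑ e with e.2 ∈ N.snk, g e = ∑ e with e.1 ∈ N.src, g e := by
  have h1 : ∑ x : V, (∑ e with e.2 = x, g e - ∑ e with e.1 = x, g e) = 0 := by
    rw [Finset.sum_sub_distrib, sum_sum_filter_eq, sum_sum_filter_eq]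
    simp
  have h2 : ∀ x : V, (∑ e with e.2 = x, g e - ∑ e with e.1 = x, g e) =
      (if x ∈ N.snk then ∑ e with e.2 = x, g e else 0) -
        if x ∈ N.src then ∑ e with e.1 = x, g e else 0 := by
    intro x
    have hin : x ∈ N.src → ∑ e with e.2 = x, g e = 0 := fun hx =>
      Finset.sum_eq_zero fun e he => hsrc e (by rw [(Finset.mem_filter.1 he).2]; exact hx)
    have hout : x ∈ N.snk → ∑ e with e.1 = x, g e = 0 := fun hx =>
      Finset.sum_eq_zero fun e he => hsnk e (by rw [(Finset.mem_filter.1 he).2]; exact hx)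
    by_cases hx : x ∈ N.src <;> by_cases hx' : x ∈ N.snk
    · simp [hx, hx', hin, hout]
    · simp [hx, hx', hin]
    · simp [hx, hx', hout]
    · simp [hx, hx', hcons x hx hx']
  have h3 : ∀ (c : V × V → V) (Z : Set V),
      ∑ x : V, (if x ∈ Z then ∑ e with c e = x, g e else 0) = ∑ e with c e ∈ Z, g e := by
    intro c Z
    rw [← Finset.sum_filter, sum_sum_filter_eq]
    simp
  simp only [h2] at h1
  rw [Finset.sum_sub_distrib, h3, h3] at h1
  linarith

/-- Hall's condition. Let F be the flow value, `XE` the edges in `X`, `a` the flow that `XE` sends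
into sinks, and `τ` the indicator that `X` contains a token. By conservation, the new successor
edges `D` carry at least `τ * F - a`, and by unit capacity there are at least that many, so `X` has
at least `|XE| + τ * F - a` successor edges. If `a > 0`, all `n` tokens are successors too. Together
with `a ≤ F ≤ n` and `n - 1 < F`, each case gives the bound up to an error less than one, which
integrality removes. -/
theorem card_le_card_follows (h0 : ∀ e, 0 ≤ g e) (h1 : ∀ e, g e ≤ 1)
    (hcons : ∀ x, x ∉ N.src → x ∉ N.snk → ∑ e with e.2 = x, g e = ∑ e with e.1 = x, g e)
    (hsnk : ∀ e, e.1 ∈ N.snk → g e = 0) (hsrc : ∀ e, e.2 ∈ N.src → g e = 0)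
    (hn : ∑ e with e.1 ∈ N.src, g e ≤ n) (hn' : (n : ℝ) - 1 < ∑ e with e.1 ∈ N.src, g e)
    (X : Finset (Fin n ⊕ (V × V))) :
    X.card ≤ (Finset.univ.filter fun b => ∃ a ∈ X, N.Follows g n a b).card := by
  set F := ∑ e with e.1 ∈ N.src, g e with hF
  set Y := Finset.univ.filter fun b => ∃ a ∈ X, N.Follows g n a b with hY
  have hglob := sum_snk_eq_sum_src hcons hsnk hsrc
  set XE : Finset (V × V) := X.toRight
  set D : Finset (V × V) := Finset.univ.filter fun e' => e' ∉ XE ∧ 0 < g e' ∧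
    ((∃ e ∈ XE, 0 < g e ∧ e.2 = e'.1) ∨ (∃ i, Sum.inl i ∈ X) ∧ e'.1 ∈ N.src) with hD
  set τ : ℝ := if ∃ i, Sum.inl i ∈ X then 1 else 0 with hτ
  set a := ∑ e ∈ XE with e.2 ∈ N.snk, g e with ha
  have hYE : XE ∪ D ⊆ Y.toRight := by
    intro e' he'
    simp only [Finset.mem_toRight, hY, Finset.mem_filter, Finset.mem_univ, true_and]
    rcases Finset.mem_union.1 he' with he' | he'
    · exact ⟨.inr e', Finset.mem_toRight.1 he', Or.inl rfl⟩
    · obtain ⟨-, hpos, ⟨e, he, hpe, h⟩ | ⟨⟨i, hi⟩, h⟩⟩ := (Finset.mem_filter.1 he').2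
      · exact ⟨.inr e, Finset.mem_toRight.1 he, Or.inr ⟨hpe, hpos, h⟩⟩
      · exact ⟨.inl i, hi, hpos, h⟩
  have hdisj : Disjoint XE D := Finset.disjoint_left.2 fun e he he' =>
    (Finset.mem_filter.1 he').2.1 he
  have hcardE : (XE.card : ℝ) + ∑ e ∈ D, g e ≤ (Y.toRight.card : ℝ) := by
    have h := Finset.card_le_card hYE
    rw [Finset.card_union_of_disjoint hdisj] at h
    have h' : (XE.card : ℝ) + D.card ≤ Y.toRight.card := by exact_mod_cast h
    have : ∑ e ∈ D, g e ≤ D.card := by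
      simpa using Finset.sum_le_card_nsmul D g 1 fun e _ => h1 e
    linarith
  -- the flow out of the heads of `X` is at least the flow into them
  set W : Finset V := Finset.univ.filter fun x => x ∉ N.src ∧ x ∉ N.snk ∧
    ∃ e ∈ XE, 0 < g e ∧ e.2 = x with hW
  have hout : ∑ e with e.1 ∈ W, g e + τ * F ≤ ∑ e ∈ XE, g e + ∑ e ∈ D, g e := by
    have hτF : τ * F = ∑ e with (∃ i, Sum.inl i ∈ X) ∧ e.1 ∈ N.src, g e := by
      rw [hτ]
      split_ifs with h
      · simp only [h, true_and, one_mul, hF]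
      · simp [h]
    rw [hτF, ← Finset.sum_union, ← Finset.sum_union hdisj]
    · refine sum_le_sum_of_support_subset h0 fun e he hne => ?_
      by_cases hX : e ∈ XE
      · exact Finset.mem_union_left _ hX
      · refine Finset.mem_union_right _ (Finset.mem_filter.2 ⟨Finset.mem_univ _, hX,
          lt_of_le_of_ne (h0 e) (Ne.symm hne), ?_⟩)
        rcases Finset.mem_union.1 he with he | he
        · exact Or.inl (Finset.mem_filter.1 (Finset.mem_filter.1 he).2).2.2.2
        · exact Or.inr (Finset.mem_filter.1 he).2
    · exact Finset.disjoint_left.2 fun e he he' =>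
        (Finset.mem_filter.1 (Finset.mem_filter.1 he).2).2.1 (Finset.mem_filter.1 he').2.2
  have hW' : ∑ e with e.2 ∈ W, g e = ∑ e with e.1 ∈ W, g e := by
    rw [← sum_sum_filter_eq, ← sum_sum_filter_eq]
    refine Finset.sum_congr rfl fun x hx => ?_
    have := (Finset.mem_filter.1 hx).2
    exact hcons x this.1 this.2.1
  have hin : ∑ e ∈ XE with e.2 ∉ N.snk, g e ≤ ∑ e with e.2 ∈ W, g e := by
    refine sum_le_sum_of_support_subset h0 fun e he hne => ?_
    obtain ⟨he, hk⟩ := Finset.mem_filter.1 he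
    refine Finset.mem_filter.2 ⟨Finset.mem_univ _, Finset.mem_filter.2 ⟨Finset.mem_univ _,
      fun hs => hne (hsrc e hs), hk, e, he, lt_of_le_of_ne (h0 e) (Ne.symm hne), rfl⟩⟩
  have hsplit : a + ∑ e ∈ XE with e.2 ∉ N.snk, g e = ∑ e ∈ XE, g e :=
    Finset.sum_filter_add_sum_filter_not _ _ _
  have hmain : (XE.card : ℝ) + τ * F - a ≤ Y.toRight.card := by linarith
  have haF : a ≤ F := by
    rw [hF, ← hglob]
    exact Finset.sum_le_sum_of_subset_of_nonneg
      (fun e he => Finset.mem_filter.2 ⟨Finset.mem_univ _, (Finset.mem_filter.1 he).2⟩)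
      fun e _ _ => h0 e
  have hXcard : X.card = X.toLeft.card + XE.card := (Finset.card_toLeft_add_card_toRight).symm
  have hYcard : Y.card = Y.toLeft.card + Y.toRight.card :=
    (Finset.card_toLeft_add_card_toRight).symm
  have hXl : X.toLeft.card ≤ n := by simpa using Finset.card_le_univ X.toLeft
  rw [hXcard, hYcard]
  have htok : (∃ i, Sum.inl i ∈ X) ∧ τ = 1 ∨ X.toLeft.card = 0 ∧ τ = 0 := by
    by_cases h : ∃ i, Sum.inl i ∈ X
    · exact Or.inl ⟨h, by simp [hτ, h]⟩
    · refine Or.inr ⟨?_, by simp [hτ, h]⟩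
      rw [Finset.card_eq_zero, Finset.eq_empty_iff_forall_notMem]
      exact fun i hi => h ⟨i, Finset.mem_toLeft.1 hi⟩
  have hsink : Y.toLeft.card = n ∨ a = 0 := by
    by_cases h : ∃ e ∈ XE, 0 < g e ∧ e.2 ∈ N.snk
    · left
      obtain ⟨e, he, hpe, hk⟩ := h
      have : Y.toLeft = Finset.univ := by
        refine Finset.eq_univ_iff_forall.2 fun i => ?_
        rw [Finset.mem_toLeft, hY, Finset.mem_filter]
        exact ⟨Finset.mem_univ _, .inr e, Finset.mem_toRight.1 he, hpe, hk⟩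
      rw [this]; simp
    · right
      refine Finset.sum_eq_zero fun e he => ?_
      obtain ⟨he, hk⟩ := Finset.mem_filter.1 he
      by_contra hne
      exact h ⟨e, he, lt_of_le_of_ne (h0 e) (Ne.symm hne), hk⟩
  have hXl' : (X.toLeft.card : ℝ) ≤ n := by exact_mod_cast hXl
  have hreal : (X.toLeft.card : ℝ) + XE.card < (Y.toLeft.card : ℝ) + Y.toRight.card + 1 := by
    rcases htok with ⟨-, ht⟩ | ⟨ht0, ht⟩ <;> rcases hsink with hs | hs
    · rw [hs]; rw [ht] at hmain; linarith
    · rw [ht, hs] at hmain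
      have : (0 : ℝ) ≤ Y.toLeft.card := Nat.cast_nonneg _
      linarith
    · rw [hs, ht0]; rw [ht] at hmain; push_cast; linarith
    · rw [ht0]; rw [ht, hs] at hmain
      have : (0 : ℝ) ≤ Y.toLeft.card := Nat.cast_nonneg _
      push_cast; linarith
  have : X.toLeft.card + XE.card < Y.toLeft.card + Y.toRight.card + 1 := by exact_mod_cast hreal
  omega

/-- A permutation that respects the successor relation yields edge-disjoint walks. -/
theorem exists_walks_of_follows (φ : Fin n ⊕ (V × V) → Fin n ⊕ (V × V))
    (hφ : Function.Injective φ) (hf : ∀ a, N.Follows g n a (φ a)) :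
    ∃ (m : Fin n → ℕ) (w : Fin n → ℕ → V), (∀ i, w i 0 ∈ N.src) ∧ (∀ i, w i (m i) ∈ N.snk) ∧
      (∀ i, ∀ k < m i, 0 < g (w i k, w i (k + 1))) ∧
      ∀ i j, ∀ k < m i, ∀ l < m j,
        (w i k, w i (k + 1)) = (w j l, w j (l + 1)) → i = j := by
  have hex : ∀ i : Fin n, ∃ k, ∃ j, φ^[k + 1] (.inl i) = .inl j := by
    intro i
    -- An injection of a finite set is a permutation, so the orbit of a token returns to a token;
    -- the edges before the first return form the walk.
    obtain ⟨k, hk, h⟩ := Function.Injective.mem_periodicPts hφ (.inl i : Fin n ⊕ (V × V))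
    exact ⟨k - 1, i, by rw [Nat.sub_add_cancel hk]; exact h⟩
  have hmin : ∀ i, ∀ k < Nat.find (hex i), ∃ e, φ^[k + 1] (.inl i) = .inr e := by
    intro i k hk
    rcases h : φ^[k + 1] (.inl i) with j | e
    · exact absurd ⟨j, h⟩ (Nat.find_min (hex i) hk)
    · exact ⟨e, rfl⟩
  have hspec := fun i => Nat.find_spec (hex i)
  generalize hM : (fun i => Nat.find (hex i)) = M at *
  have hM' : ∀ i, Nat.find (hex i) = M i := fun i => congrFun hM i
  simp only [hM'] at hmin hspec
  clear hM hM'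
  rcases isEmpty_or_nonempty (Fin n) with hemp | ⟨⟨i₀⟩⟩
  · exact ⟨isEmptyElim, isEmptyElim, isEmptyElim, isEmptyElim, isEmptyElim, isEmptyElim⟩
  have hne : Nonempty (V × V) := by
    have := hf (.inl i₀)
    rcases h : φ (.inl i₀) with j | e
    · rw [h] at this; exact this.elim
    · exact ⟨e⟩
  choose! e he using hmin
  have hstep : ∀ i k, φ^[k + 1] (.inl i) = φ (φ^[k] (.inl i)) := fun i k =>
    Function.iterate_succ_apply' φ k _
  have hM0 : ∀ i, 0 < M i := by
    intro i
    by_contra h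
    obtain ⟨j, hj⟩ := hspec i
    have h' : M i = 0 := by omega
    rw [h'] at hj
    have := hf (.inl i)
    have hj' : φ (.inl i) = .inl j := hj
    rw [hj'] at this
    exact this
  have hfirst : ∀ i, 0 < g (e i 0) ∧ (e i 0).1 ∈ N.src := by
    intro i
    have h1 : φ (.inl i) = .inr (e i 0) := he i 0 (hM0 i)
    have := hf (.inl i)
    rw [h1] at this
    exact this
  have hnext : ∀ i k, k + 1 < M i →
      0 < g (e i k) ∧ 0 < g (e i (k + 1)) ∧ (e i k).2 = (e i (k + 1)).1 := by
    intro i k hk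
    have h1 : φ (.inr (e i k)) = .inr (e i (k + 1)) := by
      rw [← he i k (by omega), ← he i (k + 1) hk, hstep i (k + 1)]
    have h2 := hf (.inr (e i k))
    rw [h1] at h2
    rcases h2 with h2 | h2
    -- An edge fixed by `φ` has only itself as preimage, so injectivity would make the starting
    -- token a fixed point, although it is followed by an edge.
    · exfalso
      have h3 : φ^[k + 1] (.inl i) = φ^[k + 1] (φ (.inl i)) := by
        rw [← Function.iterate_succ_apply, he i (k + 1) hk, he i k (by omega), h2]
      have h4 := hφ.iterate (k + 1) h3
      have h5 := he i 0 (hM0 i)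
      rw [Function.iterate_one, ← h4] at h5
      cases h5
    · exact h2
  have hlast : ∀ i, (e i (M i - 1)).2 ∈ N.snk := by
    intro i
    obtain ⟨j, hj⟩ := hspec i
    have hMi := hM0 i
    have h1 : φ (.inr (e i (M i - 1))) = .inl j := by
      rw [← he i (M i - 1) (by omega), ← hj, hstep i (M i), Nat.sub_add_cancel hMi]
    have h2 := hf (.inr (e i (M i - 1)))
    rw [h1] at h2
    exact h2.2
  have hpos : ∀ i, ∀ k < M i, 0 < g (e i k) := by
    intro i k hk
    cases k with
    | zero => exact (hfirst i).1
    | succ k => exact (hnext i k hk).2.1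
  have hedge : ∀ i, ∀ k < M i,
      ((fun k => if k = 0 then (e i 0).1 else (e i (k - 1)).2 : ℕ → V) k,
        (fun k => if k = 0 then (e i 0).1 else (e i (k - 1)).2 : ℕ → V) (k + 1)) = e i k := by
    intro i k hk
    cases k with
    | zero => simp
    | succ k => simp [(hnext i k hk).2.2]
  have hdis : ∀ i j k l, k < M i → l < M j → k ≤ l → e i k = e j l → i = j := by
    intro i j k l hk hl hkl heq
    -- Pulling a common edge back `k + 1` times reaches the token `i` on one side; on the other side
    -- this is an edge unless `k = l`.
    have h1 : φ^[k + 1] (.inl i) = φ^[k + 1] (φ^[l - k] (.inl j)) := by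
      rw [← Function.iterate_add_apply, show k + 1 + (l - k) = l + 1 by omega, he i k hk,
        he j l hl, heq]
    have h2 := hφ.iterate _ h1
    rcases Nat.eq_zero_or_pos (l - k) with h | h
    · rw [h] at h2
      exact Sum.inl.inj h2
    · have h3 := he j (l - k - 1) (by omega)
      rw [Nat.sub_add_cancel h, ← h2] at h3
      cases h3
  refine ⟨M, fun i k => if k = 0 then (e i 0).1 else (e i (k - 1)).2, fun i => ?_, fun i => ?_,
    fun i k hk => ?_, fun i j k hk l hl heq => ?_⟩
  · simpa using (hfirst i).2
  · simpa [(hM0 i).ne'] using hlast i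
  · rw [hedge i k hk]; exact hpos i k hk
  · rw [hedge i k hk, hedge j l hl] at heq
    rcases le_total k l with h | h
    · exact hdis i j k l hk hl h heq
    · exact (hdis j i l k hl hk h heq.symm).symm

/-- A flow of value greater than `n - 1` and at most `n` uses the edges of `n` edge-disjoint walks
from the sources to the sinks. -/
theorem IsFlow.exists_disjoint_walks {f : V × V → ℝ} (hf : N.IsFlow f) (hn : N.value f ≤ n)
    (hn' : (n : ℝ) - 1 < N.value f) :
    ∃ (m : Fin n → ℕ) (w : Fin n → ℕ → V), (∀ i, w i 0 ∈ N.src) ∧ (∀ i, w i (m i) ∈ N.snk) ∧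
      (∀ i, ∀ k < m i, (w i k, w i (k + 1)) ∈ N.E ∧ 0 < f (w i k, w i (k + 1))) ∧
      ∀ i j, ∀ k < m i, ∀ l < m j,
        (w i k, w i (k + 1)) = (w j l, w j (l + 1)) → i = j := by
  set g : V × V → ℝ := fun e => if e ∈ N.edges then f e else 0 with hg
  have hsum : ∀ p : V × V → Prop, ∑ e with p e, g e = ∑ e ∈ N.edges with p e, f e := by
    intro p
    simp only [hg, Finset.sum_filter, edges]
    refine Finset.sum_congr rfl fun e _ => ?_
    by_cases h1 : p e <;> by_cases h2 : e ∈ N.E <;> simp [h1, h2]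
  have h0 : ∀ e, 0 ≤ g e := fun e => by
    simp only [hg]; split_ifs with h
    exacts [(hf.capacity e h).1, le_rfl]
  have h1 : ∀ e, g e ≤ 1 := fun e => by
    simp only [hg]; split_ifs with h
    exacts [(hf.capacity e h).2, zero_le_one]
  have hcons : ∀ x, x ∉ N.src → x ∉ N.snk → ∑ e with e.2 = x, g e = ∑ e with e.1 = x, g e :=
    fun x hx hx' => by rw [hsum, hsum]; exact hf.conservation x hx hx'
  have hsnk : ∀ e, e.1 ∈ N.snk → g e = 0 := fun e he => by
    simp only [hg]; split_ifs with h
    exacts [hf.boundary e h (Or.inl he), rfl]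
  have hsrc : ∀ e, e.2 ∈ N.src → g e = 0 := fun e he => by
    simp only [hg]; split_ifs with h
    exacts [hf.boundary e h (Or.inr he), rfl]
  have hval : N.value f = ∑ e with e.1 ∈ N.src, g e := (hsum _).symm
  rw [hval] at hn hn'
  -- Hall's marriage theorem.
  obtain ⟨φ, hφ, hφf⟩ := (Fintype.all_card_le_filter_rel_iff_exists_injective
    (N.Follows g n)).1 fun X => by
      convert card_le_card_follows h0 h1 hcons hsnk hsrc hn hn' X
  obtain ⟨m, w, hw0, hwm, hw, hdis⟩ := exists_walks_of_follows φ hφ hφf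
  refine ⟨m, w, hw0, hwm, fun i k hk => ?_, hdis⟩
  have := hw i k hk
  simp only [hg] at this
  split_ifs at this with h
  · exact ⟨mem_edges.1 h, this⟩
  · exact absurd this (lt_irrefl _)

theorem IsFlow.value_nonneg {f : V × V → ℝ} (hf : N.IsFlow f) : 0 ≤ N.value f :=
  Finset.sum_nonneg fun e he => (hf.capacity e (Finset.mem_filter.1 he).1).1

theorem IsFlow.value_le_card {f : V × V → ℝ} (hf : N.IsFlow f) : N.value f ≤ N.edges.card := by
  have h := Finset.sum_le_card_nsmul (N.edges.filter fun e => e.1 ∈ N.src) f 1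
    fun e he => (hf.capacity e (Finset.mem_filter.1 he).1).2
  have h' : ((N.edges.filter fun e => e.1 ∈ N.src).card : ℝ) ≤ N.edges.card := by
    exact_mod_cast Finset.card_filter_le _ _
  rw [nsmul_eq_mul, mul_one] at h
  exact h.trans h'

theorem IsFlow.exists_walk {f : V × V → ℝ} (hf : N.IsFlow f) (hpos : 0 < N.value f) :
    ∃ (m : ℕ) (w : ℕ → V), w 0 ∈ N.src ∧ w m ∈ N.snk ∧
      ∀ k < m, (w k, w (k + 1)) ∈ N.E ∧ 0 < f (w k, w (k + 1)) := by
  have hceil := Nat.ceil_lt_add_one hpos.le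
  obtain ⟨m, w, h0, hm, hw, -⟩ := hf.exists_disjoint_walks (Nat.le_ceil _) (by linarith)
  let i : Fin ⌈N.value f⌉₊ := ⟨0, Nat.ceil_pos.2 hpos⟩
  exact ⟨m i, w i, h0 i, hm i, hw i⟩

/-- Every flow can be replaced by an integral one on the same edges, of at least the same value. -/
theorem IsFlow.exists_integral {s : V} (hs : N.src = {s}) {f : V × V → ℝ} (hf : N.IsFlow f) :
    ∃ f', N.IsFlow f' ∧ (∃ n : ℕ, N.value f' = n ∧ N.value f ≤ n) ∧
      ∀ e ∈ N.edges, f' e ≠ 0 → 0 < f e := by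
  by_cases hsnk : s ∈ N.snk
  -- No flow leaves a sink, so here the value is zero and `f` itself serves.
  · refine ⟨f, hf, ⟨0, ?_⟩, fun e he hne => lt_of_le_of_ne (hf.capacity e he).1 (Ne.symm hne)⟩
    have : N.value f = 0 := Finset.sum_eq_zero fun e he => by
      obtain ⟨he, he'⟩ := Finset.mem_filter.1 he
      rw [hs] at he'
      exact hf.boundary e he (Or.inl (by rw [Set.mem_singleton_iff.1 he']; exact hsnk))
    rw [this]; simp
  · have hceil := Nat.ceil_lt_add_one hf.value_nonneg
    obtain ⟨m, w, h0, hm, hw, hdis⟩ :=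
      hf.exists_disjoint_walks (Nat.le_ceil _) (by linarith)
    obtain ⟨f', hf', hval, hsupp⟩ := exists_flow_of_disjoint hs hsnk
      (fun i x y => ∃ k < m i, (w i k, w i (k + 1)) = (x, y))
      (fun i x y ⟨k, hk, h⟩ _ => h ▸ (hw i k hk).1)
      (fun i j x y ⟨k, hk, h⟩ ⟨l, hl, h'⟩ _ => hdis i j k hk l hl (h.trans h'.symm))
      (fun i => ⟨w i (m i), hm i, by
        have h := h0 i
        rw [hs] at h
        rw [← Set.mem_singleton_iff.1 h]
        exact reflTransGen_of_walk (r := fun x y => ∃ k < m i, (w i k, w i (k + 1)) = (x, y))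
          (fun k hk => ⟨k, hk, rfl⟩) le_rfl⟩)
    refine ⟨f', hf', ⟨_, hval.trans (by rw [Fintype.card_fin]), Nat.le_ceil _⟩, fun e _ hne => ?_⟩
    obtain ⟨i, k, hk, h⟩ := hsupp e hne
    have h' : e = (w i k, w i (k + 1)) := h.symm
    rw [h']
    exact (hw i k hk).2

end Decomposition

end FlowNetwork

end TestSynth

namespace TestSynth

universe u v w

/-! ### Runs, executions and their state-history traces. -/

namespace TestProblem

variable {S : Type u} {A : Type v} {AP : Type w} {P : TestProblem S A AP}

theorem isIdempotent_Bπ : P.Bπ.IsIdempotent :=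
  (isIdempotent_objectiveBA _).prod (isIdempotent_objectiveBA _)

theorem hist_pre (σ : ℕ → S) (k : ℕ) :
    P.hist (pre σ k) = P.Bπ.stateAt (fun i => P.T.L (σ i)) k := by
  rw [hist, pre, List.map_map]
  exact DBA.run_map_range _ (fun i => P.T.L (σ i)) k

theorem trace_eq (σ : ℕ → S) (k : ℕ) :
    P.trace σ k = (σ k, P.Bπ.stateAt (fun i => P.T.L (σ i)) k) := by
  rw [trace, hist_pre]

theorem trace_zero {σ : ℕ → S} (h0 : σ 0 = P.T.s₀) : P.trace σ 0 = P.source := by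
  rw [trace_eq, DBA.stateAt, h0]; rfl

theorem prodEdge_trace {σ : ℕ → S} {k : ℕ} (h : P.T.Edge (σ k) (σ (k + 1))) :
    ProdEdge P.T P.Bπ (P.trace σ k) (P.trace σ (k + 1)) := by
  rw [trace_eq, trace_eq]
  exact ⟨h, rfl⟩

/-- The automaton is deterministic, so the states along a walk in `G` determine its histories. -/
theorem trace_of_walk {w : ℕ → P.Node} {m : ℕ} (h0 : w 0 = P.source)
    (hw : ∀ k < m, ProdEdge P.T P.Bπ (w k) (w (k + 1))) {k : ℕ} (hk : k ≤ m) :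
    P.trace (fun i => (w i).1) k = w k := by
  rw [trace_eq]
  refine Prod.ext rfl ?_
  induction k with
  | zero => rw [DBA.stateAt, h0]; rfl
  | succ k ih => rw [DBA.stateAt, ← (hw k hk).2]; exact congrArg (P.Bπ.step · _) (ih (by omega))

theorem trace_const {σ : ℕ → S} {m : ℕ} (h : ∀ k, m ≤ k → σ k = σ m) {k : ℕ} (hk : m ≤ k) :
    P.trace σ k = P.trace σ m := by
  rw [trace_eq, trace_eq, h k hk]
  exact congrArg _ (isIdempotent_Bπ.stateAt_const (fun j hj => by rw [h j hj]) hk)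

theorem pre_congr {σ σ' : ℕ → S} {k : ℕ} (h : ∀ i ≤ k, σ i = σ' i) : pre σ k = pre σ' k :=
  List.map_congr_left fun i hi => h i (by have := List.mem_range.1 hi; omega)

theorem length_pre (σ : ℕ → S) (k : ℕ) : (pre σ k).length = k + 1 := by simp [pre]

theorem getLast?_pre (σ : ℕ → S) (k : ℕ) : (pre σ k).getLast? = some (σ k) := by
  simp [pre, List.range_succ]

theorem isPrefix_pre {σ : ℕ → S} {k : ℕ} (h0 : σ 0 = P.T.s₀)
    (h : ∀ i < k, P.T.Edge (σ i) (σ (i + 1))) : P.T.IsPrefix (pre σ k) := by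
  refine ⟨by simp [pre, List.range_succ_eq_map, h0], ?_⟩
  rw [List.isChain_iff_getElem]
  intro i hi
  rw [length_pre] at hi
  simpa [pre] using h i (by omega)

theorem step_hist_getLast {l : List S} {s : S} (h : l.getLast? = some s) :
    P.Bπ.step (P.hist l) (P.T.L s) = P.hist l := by
  obtain ⟨l, rfl⟩ := List.getLast?_eq_some_iff.1 h
  simp only [hist, DBA.run, List.map_append, List.foldl_append]
  exact isIdempotent_Bπ _ _

theorem Reach.exists_walk {x : P.Node} (hx : P.Reach x) :
    ∃ (m : ℕ) (w : ℕ → P.Node), w 0 = P.source ∧ w m = x ∧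
      ∀ k < m, ProdEdge P.T P.Bπ (w k) (w (k + 1)) :=
  exists_walk_of_reflTransGen hx

theorem Reach.exists_prefix {x : P.Node} (hx : P.Reach x) :
    ∃ l, P.T.IsPrefix l ∧ P.hist l = x.2 := by
  obtain ⟨m, w, h0, hm, hw⟩ := hx.exists_walk
  refine ⟨_, isPrefix_pre (σ := fun i => (w i).1) (k := m) (by rw [h0]; rfl)
    fun i hi => (hw i hi).1, ?_⟩
  have := trace_of_walk h0 hw le_rfl
  rw [hm] at this
  exact congrArg Prod.snd this

/-- A trace of the system that ends, or goes on for ever. -/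
structure IsRun (P : TestProblem S A AP) (σ : ℕ → S) : Prop where
  zero : σ 0 = P.T.s₀
  step : ∀ k, P.T.Edge (σ k) (σ (k + 1)) ∨ P.T.Terminal (σ k) ∧ σ (k + 1) = σ k

theorem IsExecution.isRun {πs : List S → A} {πt : List S → Set A} {σ : ℕ → S}
    (h : P.IsExecution πs πt σ) : P.IsRun σ :=
  ⟨h.1, fun k => (h.2 k).symm.imp (fun h => ⟨_, h.2⟩) id⟩

/-- Stopping and moving exclude each other. Hence the execution that witnesses the correctness of a
strategy is the only one it has. -/
theorem IsExecution.unique {πs : List S → A} {πt : List S → Set A} {σ σ' : ℕ → S}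
    (h : P.IsExecution πs πt σ) (h' : P.IsExecution πs πt σ') : σ = σ' := by
  have key : ∀ k, ∀ i ≤ k, σ i = σ' i := by
    intro k
    induction k with
    | zero => intro i hi; rw [Nat.le_zero.1 hi, h.1, h'.1]
    | succ k ih =>
      intro i hi
      rcases Nat.le_succ_iff.1 hi with hi | rfl
      · exact ih i hi
      · have hk := ih k le_rfl
        have hp := pre_congr ih
        have h₂ := h'.2 k
        rw [← hk, ← hp] at h₂
        rcases h.2 k with ⟨ht, h₁⟩ | ⟨_, h₁⟩ <;> rcases h₂ with ⟨ht', h₂⟩ | ⟨_, h₂⟩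
        · rw [h₁, h₂]
        · exact absurd ⟨_, h₂⟩ (ht _)
        · exact absurd ⟨_, h₁⟩ (ht' _)
        · exact Option.some.inj (h₁.symm.trans h₂)
  exact funext fun k => key k k le_rfl

theorem IsRun.eq_of_terminal {σ : ℕ → S} (h : P.IsRun σ) {m : ℕ} (hm : P.T.Terminal (σ m))
    {k : ℕ} (hk : m ≤ k) : σ k = σ m := by
  induction k, hk using Nat.le_induction with
  | base => rfl
  | succ k _ ih =>
    rcases h.step k with h | h
    · rw [ih] at h; exact absurd h (hm _)
    · rw [h.2, ih]

theorem exists_terminal_of_mem_target (hsys : P.IsSystemObjective) {σ : ℕ → S} {k : ℕ}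
    (h : P.trace σ k ∈ P.target) : ∃ j ≤ k, P.T.Terminal (σ j) := by
  obtain ⟨t, ht, p, hp, hterm⟩ := hsys
  rw [trace_eq] at h
  have h' : ((P.Bsys.prod P.Btest).stateAt (fun i => P.T.L (σ i)) k).1 ∈ P.Bsys.acc := h
  rw [DBA.stateAt_prod] at h'
  obtain ⟨j, hj, hpj⟩ := exists_mem_of_stateAt_mem_acc hp (stateAt_mem_acc_of_mem ht h')
  exact ⟨j, hj, hterm _ hpj⟩

/-- An accepting system history has read a proposition that holds only in terminal states; a walk
cannot leave such a state, so it is the last one. -/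
theorem Reach.terminal_of_mem_target (hsys : P.IsSystemObjective) {x : P.Node} (hx : P.Reach x)
    (h : x ∈ P.target) : P.T.Terminal x.1 := by
  obtain ⟨m, w, h0, rfl, hw⟩ := hx.exists_walk
  rw [← trace_of_walk h0 hw le_rfl] at h
  obtain ⟨j, hj, hterm⟩ := exists_terminal_of_mem_target hsys h
  rcases hj.eq_or_lt with rfl | hj
  · exact hterm
  · exact absurd (hw j hj).1 (hterm _)

theorem IsRun.satisfies_iff {σ : ℕ → S} (h : P.IsRun σ) {m : ℕ} (hm : P.T.Terminal (σ m)) :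
    (P.Satisfies σ P.φsys ↔ P.trace σ m ∈ P.target) ∧
      (P.Satisfies σ P.φtest ↔ (P.trace σ m).2.2 ∈ P.Btest.acc) := by
  have hω : ∀ j, m ≤ j → P.T.L (σ j) = P.T.L (σ m) := fun j hj => by
    rw [h.eq_of_terminal hm hj]
  have htr : (P.trace σ m).2 = (P.Bsys.stateAt (fun i => P.T.L (σ i)) m,
      P.Btest.stateAt (fun i => P.T.L (σ i)) m) := by
    rw [trace_eq]; exact DBA.stateAt_prod _ _ _ _
  refine ⟨?_, ?_⟩
  · refine (sat_objective_iff P.φsys hω).trans ?_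
    change _ ↔ (P.trace σ m).2.1 ∈ P.Bsys.acc
    rw [htr]
  · refine (sat_objective_iff P.φtest hω).trans ?_
    rw [htr]

theorem IsRun.exists_terminal (hsys : P.IsSystemObjective) {σ : ℕ → S}
    (hs : P.Satisfies σ P.φsys) : ∃ m, P.T.Terminal (σ m) := by
  obtain ⟨t, ht, p, hp, hterm⟩ := hsys
  obtain ⟨k, hk⟩ := exists_mem_of_sat_of_finalProp hp (sat_of_mem ht hs)
  exact ⟨k, hterm _ hk⟩

/-- A run that satisfies the system objective ends, at its first terminal state, in a target
node. -/
theorem IsRun.exists_mem_target (hsys : P.IsSystemObjective) {σ : ℕ → S} (h : P.IsRun σ)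
    (hs : P.Satisfies σ P.φsys) : ∃ m, P.trace σ m ∈ P.target ∧ P.T.Terminal (σ m) ∧
      ∀ k < m, ¬ P.T.Terminal (σ k) := by
  have hex := IsRun.exists_terminal hsys hs
  have hm := Nat.find_spec hex
  exact ⟨Nat.find hex, (h.satisfies_iff hm).1.1 hs, hm, fun k hk => Nat.find_min hex hk⟩

theorem test_acc_mono (htest : P.IsTestObjective) {σ : ℕ → S} {i j : ℕ} (hij : i ≤ j)
    (h : (P.trace σ i).2.2 ∈ P.Btest.acc) : (P.trace σ j).2.2 ∈ P.Btest.acc := by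
  induction j, hij using Nat.le_induction with
  | base => exact h
  | succ j _ ih =>
    rw [trace_eq] at ih ⊢
    exact step_mem_acc_of_forall_isReach htest.2 ih _

theorem exists_isExecution [Nonempty A] {πt : List S → Set A} {σ : ℕ → S} {m : ℕ}
    (h0 : σ 0 = P.T.s₀) (hm : P.T.Terminal (σ m)) (hconst : ∀ k, m ≤ k → σ k = σ m)
    (hstep : ∀ k < m, ∃ a, a ∉ πt (pre σ k) ∧ P.T.δ (σ k) a = some (σ (k + 1))) :
    ∃ πs, P.IsExecution πs πt σ := by
  choose! act hact using hstep
  -- Only one execution has to be produced, so the strategy may depend on time alone; the prefix at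
  -- time `k` has length `k + 1`.
  refine ⟨fun l => act (l.length - 1), h0, fun k => ?_⟩
  rcases lt_or_ge k m with hk | hk
  · right
    dsimp only
    rw [length_pre, Nat.add_sub_cancel]
    exact hact k hk
  · left
    rw [hconst k hk, hconst (k + 1) (by omega)]
    exact ⟨hm, rfl⟩

/-- A walk on the nodes of `G` along which the test strategy restricts no step. -/
def IsAllowedWalk (P : TestProblem S A AP) (πt : List S → Set A) (w : ℕ → P.Node) (m : ℕ) : Prop :=
  w 0 = P.source ∧ ∀ k < m, ProdEdge P.T P.Bπ (w k) (w (k + 1)) ∧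
    ∃ a, a ∉ πt (pre (fun i => (w i).1) k) ∧ P.T.δ (w k).1 a = some (w (k + 1)).1

/-- The end of the walk lies over a terminal state, so the walk frozen at its end is an execution,
and it ends in an accepting system history. -/
theorem IsAllowedWalk.mem_correctExecutions [Nonempty A] (hsys : P.IsSystemObjective)
    {πt : List S → Set A} {w : ℕ → P.Node} {m : ℕ} (hw : P.IsAllowedWalk πt w m)
    (hm : w m ∈ P.target) :
    ∃ σ ∈ P.correctExecutions πt, ∀ k, P.trace σ k = w (min k m) := by
  have hterm : P.T.Terminal (w m).1 := by
    refine Reach.terminal_of_mem_target hsys ?_ hm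
    rw [Reach, ← hw.1]
    exact reflTransGen_of_walk (fun k hk => (hw.2 k hk).1) le_rfl
  have hconst : ∀ k, m ≤ k → (w (min k m)).1 = (w (min m m)).1 := fun k hk => by
    rw [min_eq_right hk, min_self]
  have htr : ∀ k, P.trace (fun k => (w (min k m)).1) k = w (min k m) := by
    have hle : ∀ k ≤ m, P.trace (fun k => (w (min k m)).1) k = w (min k m) := fun k hk =>
      trace_of_walk (w := fun k => w (min k m)) (m := m) (by simpa using hw.1) (fun k hk => by
        simpa [min_eq_left hk.le, min_eq_left (Nat.succ_le_of_lt hk)] using (hw.2 k hk).1) hk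
    intro k
    rcases le_total k m with hk | hk
    · exact hle k hk
    · rw [trace_const (σ := fun k => (w (min k m)).1) hconst hk, hle m le_rfl, min_self,
        min_eq_right hk]
  obtain ⟨πs, hπs⟩ : ∃ πs, P.IsExecution πs πt fun k => (w (min k m)).1 := by
    refine exists_isExecution (m := m) (by
      rw [Nat.zero_min, hw.1]; rfl)
      (by simpa using hterm) hconst fun k hk => ?_
    have hpre : pre (fun k => (w (min k m)).1) k = pre (fun i => (w i).1) k :=
      pre_congr fun i hi => by rw [min_eq_left (by omega)]
    rw [hpre]
    simpa [min_eq_left hk.le, min_eq_left (Nat.succ_le_of_lt hk)] using (hw.2 k hk).2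
  refine ⟨_, ⟨πs, ⟨_, hπs, ?_⟩, hπs⟩, htr⟩
  refine (hπs.isRun.satisfies_iff (m := m) (by simpa using hterm)).1.2 ?_
  rw [htr, min_self]
  exact hm

/-- The steps of an execution before its end are allowed. -/
theorem isAllowedWalk_trace {πs : List S → A} {πt : List S → Set A} {σ : ℕ → S}
    (h : P.IsExecution πs πt σ) {m : ℕ} (hm : ∀ k < m, ¬ P.T.Terminal (σ k)) :
    P.IsAllowedWalk πt (P.trace σ) m := by
  refine ⟨trace_zero h.1, fun k hk => ?_⟩
  rcases h.2 k with h | h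
  · exact absurd h.1 (hm k hk)
  · exact ⟨prodEdge_trace ⟨_, h.2⟩, _, h⟩

end TestProblem

end TestSynth

namespace TestSynth

universe u v w

namespace TestProblem

variable {S : Type u} {A : Type v} {AP : Type w} {P : TestProblem S A AP} [Fintype S]
  {env : TestEnv S}

theorem source_notMem_target_of_value_pos {f : P.Node × P.Node → ℝ} (hf : P.net.IsFlow f)
    (hpos : 0 < P.net.value f) : P.source ∉ P.target := by
  intro h
  refine hpos.ne' (Finset.sum_eq_zero fun e he => ?_)
  obtain ⟨he, he'⟩ := Finset.mem_filter.1 he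
  exact hf.boundary e he (Or.inl (by rw [show e.1 = P.source from he']; exact h))

/-! ### Size of the penalty and existence of an optimum. -/

section Optimum

theorem MILPFeasible.d_eq_zero {x : P.MILPPoint} (hx : P.MILPFeasible env x)
    {e : P.Node × P.Node} (he : e ∈ P.net.edges) (hf : 0 < x.f e) : x.d e = 0 := by
  rcases hx.binary e he with h | h
  · exact h
  · have := hx.cut e he
    linarith

theorem penalty_nonneg {x : P.MILPPoint} (hx : P.MILPFeasible env x) :
    0 ≤ 1 / (P.net.edges.card : ℝ) * ∑ e ∈ P.net.edges, x.d e :=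
  mul_nonneg (by positivity) (Finset.sum_nonneg fun e he => by
    rcases hx.binary e he with h | h <;> rw [h]; exact zero_le_one)

/-- Some edge carries flow and is therefore uncut, so fewer than all edges are cut. -/
theorem penalty_lt_one {x : P.MILPPoint} (hx : P.MILPFeasible env x)
    (hpos : 0 < P.net.value x.f) :
    1 / (P.net.edges.card : ℝ) * ∑ e ∈ P.net.edges, x.d e < 1 := by
  obtain ⟨e, he, hfe⟩ : ∃ e ∈ P.net.edges, 0 < x.f e := by
    by_contra! h
    exact hpos.not_ge (Finset.sum_nonpos fun e he => h e (Finset.mem_filter.1 he).1)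
  have hlt : ∑ e ∈ P.net.edges, x.d e < ∑ _e ∈ P.net.edges, (1 : ℝ) :=
    Finset.sum_lt_sum (fun e he => by rcases hx.binary e he with h | h <;> rw [h]; exact zero_le_one)
      ⟨e, he, by rw [hx.d_eq_zero he hfe]; exact zero_lt_one⟩
  have hcard : (0 : ℝ) < P.net.edges.card := by exact_mod_cast Finset.card_pos.2 ⟨e, he⟩
  rw [one_div, inv_mul_lt_iff₀ hcard, mul_one]
  simpa using hlt

theorem IsOptimal.lt_value {x y : P.MILPPoint} (hx : P.IsOptimal env x)
    (hy : P.MILPFeasible env y) (hpos : 0 < P.net.value y.f) :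
    P.net.value y.f - 1 < P.net.value x.f := by
  have h := hx.2 y hy
  have h1 := penalty_lt_one hy hpos
  have h2 := penalty_nonneg hx.1
  unfold objective at h
  linarith

theorem MILPFeasible.exists_integral {x : P.MILPPoint} (hx : P.MILPFeasible env x) :
    ∃ y, P.MILPFeasible env y ∧ (∃ n : ℕ, P.net.value y.f = n) ∧
      P.objective x ≤ P.objective y := by
  obtain ⟨f, hf, ⟨n, hn, hle⟩, hsupp⟩ := hx.flow.exists_integral (s := P.source) rfl
  refine ⟨{ x with f := f }, { hx with flow := hf, cut := fun e he => ?_ }, ⟨n, hn⟩, ?_⟩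
  · change x.d e + f e ≤ 1
    by_cases h : f e = 0
    · rw [h]
      rcases hx.binary e he with h | h <;> rw [h] <;> norm_num
    · rw [hx.d_eq_zero he (hsupp e he h), zero_add]
      exact (hf.capacity e he).2
  · change P.net.value x.f - _ ≤ P.net.value f - _
    rw [hn]
    exact sub_le_sub_right hle _

/-- Making the flow integral does not lower the objective. For integral flow values the objective is
`n - c / |E|` with natural numbers `n, c ≤ |E|`, which leaves finitely many values. -/
theorem exists_isOptimal {x : P.MILPPoint} (hx : P.MILPFeasible env x) :
    ∃ y, P.IsOptimal env y := by
  set Z : Set ℝ := {v | ∃ y, P.MILPFeasible env y ∧ (∃ n : ℕ, P.net.value y.f = n) ∧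
    P.objective y = v} with hZ
  have hfin : Z.Finite := by
    refine ((Set.finite_le_nat P.net.edges.card).prod (Set.finite_le_nat P.net.edges.card)).image
      (fun p : ℕ × ℕ => (p.1 : ℝ) - 1 / (P.net.edges.card : ℝ) * p.2) |>.subset ?_
    rintro v ⟨y, hy, ⟨n, hn⟩, rfl⟩
    refine ⟨(n, (P.net.edges.filter fun e => y.d e = 1).card), ⟨?_, ?_⟩, ?_⟩
    · have := hy.flow.value_le_card
      rw [hn] at this
      exact_mod_cast this
    · exact Finset.card_filter_le _ _
    · have : ∑ e ∈ P.net.edges, y.d e = (P.net.edges.filter fun e => y.d e = 1).card := by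
        rw [Finset.card_filter, Nat.cast_sum]
        refine Finset.sum_congr rfl fun e he => ?_
        rcases hy.binary e he with h | h <;> simp [h]
      simp only [objective, hn, this]
  obtain ⟨y₀, hy₀, hn₀, -⟩ := hx.exists_integral
  obtain ⟨v, ⟨y, hy, -, rfl⟩, hmax⟩ := Set.exists_max_image Z id hfin ⟨_, y₀, hy₀, hn₀, rfl⟩
  refine ⟨y, hy, fun z hz => ?_⟩
  obtain ⟨z', hz', hn, hle⟩ := hz.exists_integral
  exact hle.trans (hmax _ ⟨z', hz', hn, rfl⟩)

end Optimum

/-! ### From the cuts of a feasible point to a feasible test strategy. -/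

section StrategyOfCuts

variable {d : P.Node × P.Node → ℝ}

theorem mem_cutMap {q : P.Bπ.Q} {s s' : S} : (s, s') ∈ P.cutMap d q ↔
    ((s, q), (s', P.Bπ.step q (P.T.L s'))) ∈ P.net.E ∧
      d ((s, q), (s', P.Bπ.step q (P.T.L s'))) = 1 := by
  constructor
  · rintro ⟨⟨x, y⟩, he, hd, h1, h2⟩
    have he' := FlowNetwork.mem_edges.1 he
    have hx : x = (s, q) := h1
    have hy : y = (s', P.Bπ.step q (P.T.L s')) := by
      refine Prod.ext h2 ?_
      rw [← he'.1.2, hx]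
      exact congrArg (fun t => P.Bπ.step q (P.T.L t)) h2
    rw [hx, hy] at he' hd
    exact ⟨he', hd⟩
  · rintro ⟨h, hd⟩
    exact ⟨_, FlowNetwork.mem_edges.2 h, hd, rfl, rfl⟩

/-- A step of a prefix to a new node is restricted by the test strategy iff its edge is cut. -/
theorem mem_testStrategy_pre {σ : ℕ → S} {k : ℕ} {a : A}
    (ha : P.T.δ (σ k) a = some (σ (k + 1))) :
    a ∈ P.testStrategy d (pre σ k) ↔ P.trace σ k ≠ P.trace σ (k + 1) ∧
      d (P.trace σ k, P.trace σ (k + 1)) = 1 := by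
  have htr : P.trace σ (k + 1) =
      (σ (k + 1), P.Bπ.step (P.hist (pre σ k)) (P.T.L (σ (k + 1)))) :=
    Prod.ext rfl (prodEdge_trace (P := P) ⟨a, ha⟩).2.symm
  have hmem : (P.trace σ k, P.trace σ (k + 1)) ∈ P.net.E ↔
      P.trace σ k ≠ P.trace σ (k + 1) :=
    ⟨fun h => h.2, fun h => ⟨prodEdge_trace ⟨a, ha⟩, h⟩⟩
  rw [← hmem, htr]
  refine Iff.trans ?_ (mem_cutMap (P := P) (d := d))
  constructor
  · rintro ⟨s, s', hs, hs', h⟩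
    rw [getLast?_pre] at hs
    obtain rfl := Option.some.inj hs
    rw [ha] at hs'
    obtain rfl := Option.some.inj hs'
    exact h
  · intro h
    exact ⟨_, _, getLast?_pre σ k, ha, h⟩

/-- The obstacles that realize the test strategy. -/
def cutObstacles (P : TestProblem S A AP) (d : P.Node × P.Node → ℝ) (l : List S) : Set (S × S) :=
  {t | t.1 ≠ t.2 ∧ t ∈ P.cutMap d (P.hist l)}

theorem realizes_cutObstacles {x : P.MILPPoint} (hx : P.MILPFeasible env x) :
    P.Realizes env (P.cutObstacles x.d) (P.testStrategy x.d) where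
  transitions := by
    rintro l ⟨s, s'⟩ ⟨-, h⟩
    exact (mem_cutMap.1 h).1.1.1
  harness := by
    rintro l ⟨s, s'⟩ ⟨-, h⟩
    obtain ⟨he, hd⟩ := mem_cutMap.1 h
    by_contra hr
    rw [hx.harness _ (FlowNetwork.mem_edges.2 he) hr] at hd
    exact zero_ne_one hd
  static_const := by
    have key : ∀ s s' : S, (s, s') ∈ env.staticArea → ∀ l l',
        (s, s') ∈ P.cutObstacles x.d l → (s, s') ∈ P.cutObstacles x.d l' := by
      rintro s s' hst l l' ⟨hne, h⟩
      obtain ⟨he, hd⟩ := mem_cutMap.1 h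
      -- Since `s ≠ s'`, the transition gives an edge of the network at every history. A transition
      -- from `s` to itself could be an edge at some histories and an excluded self-loop at others,
      -- so `cutObstacles` omits these.
      have he' : ((s, P.hist l'), (s', P.Bπ.step (P.hist l') (P.T.L s'))) ∈ P.net.E :=
        ⟨⟨he.1.1, rfl⟩, fun h => hne (congrArg Prod.fst h)⟩
      refine ⟨hne, mem_cutMap.2 ⟨he', ?_⟩⟩
      rw [← hd]
      exact (hx.static_cuts _ (FlowNetwork.mem_edges.2 he) _ (FlowNetwork.mem_edges.2 he')
        rfl rfl hst).symm
    rintro ⟨s, s'⟩ hst l l'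
    exact ⟨key s s' hst l l', key s s' hst l' l⟩
  strategy := by
    intro l s _ hs
    ext a
    constructor
    · rintro ⟨t, s', ht, ha, h⟩
      rw [hs] at ht
      obtain rfl := Option.some.inj ht
      refine ⟨s', ha, ?_, h⟩
      -- The history has already absorbed the label of `s`, so repeating `s` is a self-loop of `G`
      -- and never cut: omitting the diagonal costs nothing.
      rintro (rfl : s = s')
      refine (mem_cutMap.1 h).1.2 (Prod.ext rfl ?_)
      exact (step_hist_getLast hs).symm
    · rintro ⟨s', ha, -, h⟩
      exact ⟨s, s', hs, ha, h⟩

theorem obstaclesAt_cutObstacles_subset {q : P.Bπ.Q} {t : S × S}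
    (h : t ∈ P.obstaclesAt (P.cutObstacles d) q) : t.1 ≠ t.2 ∧ t ∈ P.cutMap d q := by
  obtain ⟨l, -, rfl, h⟩ := h
  exact h

/-- A walk over uncut edges is allowed. -/
theorem isAllowedWalk_of_uncut {w : ℕ → P.Node} {m : ℕ} (h0 : w 0 = P.source)
    (hw : ∀ k < m, (w k, w (k + 1)) ∈ P.net.E ∧ d (w k, w (k + 1)) = 0) :
    P.IsAllowedWalk (P.testStrategy d) w m := by
  have hE : ∀ k < m, ProdEdge P.T P.Bπ (w k) (w (k + 1)) := fun k hk => (hw k hk).1.1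
  refine ⟨h0, fun k hk => ⟨hE k hk, ?_⟩⟩
  obtain ⟨a, ha⟩ := (hE k hk).1
  refine ⟨a, fun h => ?_, ha⟩
  have h' := (mem_testStrategy_pre (σ := fun i => (w i).1) ha).1 h
  rw [trace_of_walk h0 hE hk.le, trace_of_walk h0 hE hk, (hw k hk).2] at h'
  exact zero_ne_one h'.2

theorem IsAllowedWalk.d_ne_one {w : ℕ → P.Node} {m : ℕ}
    (h : P.IsAllowedWalk (P.testStrategy d) w m) {k : ℕ} (hk : k < m) (hne : w k ≠ w (k + 1)) :
    d (w k, w (k + 1)) ≠ 1 := by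
  intro hd
  obtain ⟨a, hna, ha⟩ := (h.2 k hk).2
  refine hna ((mem_testStrategy_pre (σ := fun i => (w i).1) ha).2 ?_)
  have hE := fun k hk => (h.2 k hk).1
  rw [trace_of_walk h.1 hE hk.le, trace_of_walk h.1 hE hk]
  exact ⟨hne, hd⟩

theorem MILPFeasible.exists_uncut_walk {x : P.MILPPoint} (hx : P.MILPFeasible env x)
    (hpos : 0 < P.net.value x.f) : ∃ (m : ℕ) (w : ℕ → P.Node), w 0 = P.source ∧ w m ∈ P.target ∧
      ∀ k < m, (w k, w (k + 1)) ∈ P.net.E ∧ x.d (w k, w (k + 1)) = 0 := by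
  obtain ⟨m, w, h0, hm, hw⟩ := hx.flow.exists_walk hpos
  exact ⟨m, w, h0, hm, fun k hk =>
    ⟨(hw k hk).1, hx.d_eq_zero (FlowNetwork.mem_edges.2 (hw k hk).1) (hw k hk).2⟩⟩

/-- With reactive obstacles, the support of the system flow for `(q, u)` contains a path, which
`sysCut` keeps free of cuts at `q`. With static obstacles only, the sole checkpoint is the source,
and the projection of a flow-carrying walk works because a transition is cut at all histories or at
none. -/
theorem leavesPath_cutObstacles {x : P.MILPPoint} (hx : P.MILPFeasible env x)
    (hpos : 0 < P.net.value x.f) : P.LeavesPath env (P.cutObstacles x.d) := by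
  have hflow : env ≠ .static → ∀ q, ∀ u ∈ P.sysSources (P.firstObs q), ∃ t ∈ P.sysTarget,
      Relation.ReflTransGen (fun x' y => ProdEdge P.T P.Bsys x' y ∧
        (x'.1, y.1) ∉ P.obstaclesAt (P.cutObstacles x.d) q) u t := by
    intro henv q u hu
    have hv := hx.sysValue henv q u hu
    obtain ⟨m, w, h0, hm, hw⟩ := (hx.sysFlow henv q u hu).exists_walk (by linarith)
    have h0' : w 0 = u := h0
    refine ⟨w m, hm, h0' ▸ reflTransGen_of_walk (fun k hk => ⟨(hw k hk).1.1, fun hobs => ?_⟩)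
      le_rfl⟩
    obtain ⟨he, hd⟩ := mem_cutMap.1 (obstaclesAt_cutObstacles_subset hobs).2
    have hc := hx.sysCut henv q u hu _ (FlowNetwork.mem_edges.2 he) rfl _
      (FlowNetwork.mem_edges.2 (hw k hk).1) rfl rfl
    rw [hd] at hc
    linarith [(hw k hk).2]
  cases env with
  | reactive => exact hflow (by simp)
  | mixed E => exact hflow (by simp)
  | static =>
    rintro q u ⟨-, ⟨y, ⟨rfl, rfl⟩, rfl⟩, -⟩
    obtain ⟨m, w, h0, hm, hw⟩ := hx.exists_uncut_walk hpos
    refine ⟨P.proj (w m), hm, h0 ▸ reflTransGen_of_walk (w := fun k => P.proj (w k))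
      (fun k hk => ⟨⟨(hw k hk).1.1.1, congrArg Prod.fst (hw k hk).1.1.2⟩, fun hobs => ?_⟩)
      le_rfl⟩
    obtain ⟨he, hd⟩ := mem_cutMap.1 (obstaclesAt_cutObstacles_subset hobs).2
    have := hx.static_cuts _ (FlowNetwork.mem_edges.2 he) _
      (FlowNetwork.mem_edges.2 (hw k hk).1) rfl rfl (Set.mem_univ _)
    rw [hd, (hw k hk).2] at this
    exact one_ne_zero this

/-- Walks over uncut edges to the target accomplish the test objective. -/
theorem MILPFeasible.exists_mem_inter {x : P.MILPPoint} (hx : P.MILPFeasible env x)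
    {w : ℕ → P.Node} {m : ℕ} (h : P.IsAllowedWalk (P.testStrategy x.d) w m)
    (hm : w m ∈ P.target) : ∃ k ≤ m, w k ∈ P.inter := by
  by_contra! hI
  -- Off the intermediate nodes the potential cannot drop across an uncut edge, whereas `separation`
  -- demands a drop of one.
  have hmono : ∀ k ≤ m, x.μ P.source ≤ x.μ (w k) := by
    intro k
    induction k with
    | zero => intro _; rw [h.1]
    | succ k ih =>
      intro hk
      refine (ih (by omega)).trans ?_
      by_cases hne : w k = w (k + 1)
      · rw [hne]
      · have he : (w k, w (k + 1)) ∈ P.net.edges :=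
          FlowNetwork.mem_edges.2 ⟨(h.2 k hk).1, hne⟩
        have hp := hx.partition _ he (hI k (by omega)) (hI (k + 1) hk)
        have hd := (hx.binary _ he).resolve_right (h.d_ne_one hk hne)
        rw [hd] at hp
        linarith
  have := hx.separation _ hm (h.1 ▸ hI 0 (Nat.zero_le _)) (hI m le_rfl)
  linarith [hmono m le_rfl]

theorem nonempty_action_of_value_pos {f : P.Node × P.Node → ℝ} (hf : P.net.IsFlow f)
    (hpos : 0 < P.net.value f) : Nonempty A := by
  obtain ⟨m, w, h0, hm, hw⟩ := hf.exists_walk hpos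
  rcases Nat.eq_zero_or_pos m with rfl | hm0
  · exact absurd ((show w 0 = P.source from h0) ▸ hm) (source_notMem_target_of_value_pos hf hpos)
  · obtain ⟨a, -⟩ := (hw 0 hm0).1.1.1
    exact ⟨a⟩

theorem isFeasible_testStrategy (hsys : P.IsSystemObjective) (htest : P.IsTestObjective)
    {x : P.MILPPoint} (hx : P.MILPFeasible env x) (hpos : 0 < P.net.value x.f) :
    P.IsFeasible env (P.testStrategy x.d) where
  realizable := ⟨_, realizes_cutObstacles hx, leavesPath_cutObstacles hx hpos⟩
  exists_correct := by
    have := nonempty_action_of_value_pos hx.flow hpos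
    obtain ⟨m, w, h0, hm, hw⟩ := hx.exists_uncut_walk hpos
    obtain ⟨σ, ⟨πs, hπs, -⟩, -⟩ :=
      (isAllowedWalk_of_uncut h0 hw).mem_correctExecutions hsys hm
    exact ⟨πs, hπs⟩
  correct_sat := by
    rintro πs σ ⟨σ', hσ', hs⟩ hσ
    obtain rfl := hσ'.unique hσ
    refine ⟨?_, hs⟩
    obtain ⟨m, hm, hterm, hmin⟩ := hσ.isRun.exists_mem_target hsys hs
    obtain ⟨k, hk, hI⟩ := hx.exists_mem_inter (isAllowedWalk_trace hσ hmin) hm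
    exact (hσ.isRun.satisfies_iff hterm).2.2 (test_acc_mono htest hk hI.1)

theorem hasUniqueTraces_testStrategy (hsys : P.IsSystemObjective) {x : P.MILPPoint}
    (hx : P.MILPFeasible env x) (hpos : 0 < P.net.value x.f) {n : ℕ}
    (hn : (n : ℝ) < P.net.value x.f + 1) : P.HasUniqueTraces (P.testStrategy x.d) n := by
  have := nonempty_action_of_value_pos hx.flow hpos
  have hsrc := source_notMem_target_of_value_pos hx.flow hpos
  obtain ⟨m, w, h0, hm, hw, hdis⟩ := hx.flow.exists_disjoint_walks (Nat.le_ceil _)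
    (by linarith [Nat.ceil_lt_add_one hpos.le])
  have hw' : ∀ i, P.IsAllowedWalk (P.testStrategy x.d) (w i) (m i) := fun i =>
    isAllowedWalk_of_uncut (h0 i) fun k hk =>
      ⟨(hw i k hk).1, hx.d_eq_zero (FlowNetwork.mem_edges.2 (hw i k hk).1) (hw i k hk).2⟩
  choose σ hσ htr using fun i => (hw' i).mem_correctExecutions hsys (hm i)
  have hterm : ∀ i, P.T.Terminal (w i (m i)).1 := fun i => by
    refine Reach.terminal_of_mem_target hsys ?_ (hm i)
    rw [Reach, ← (hw' i).1]
    exact reflTransGen_of_walk (fun k hk => ((hw' i).2 k hk).1) le_rfl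
  have hnt : ∀ i k, ¬ P.T.Terminal (P.trace (σ i) k).1 → k < m i := fun i k h => by
    by_contra hk
    rw [htr, min_eq_right (by omega)] at h
    exact h (hterm i)
  have hunique : ∀ i j, i ≠ j → P.Unique (P.trace (σ i)) (P.trace (σ j)) := by
    rintro i j hij k l hk ⟨h1, h2⟩
    have hk' := hnt i k hk
    have hl' := hnt j l (h1 ▸ hk)
    rw [htr, htr, min_eq_left hk'.le, min_eq_left hl'.le] at h1
    rw [htr, htr, min_eq_left (Nat.succ_le_of_lt hk'), min_eq_left (Nat.succ_le_of_lt hl')] at h2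
    exact hij (hdis i j k hk' l hl' (Prod.ext h1 h2))
  have hm0 : ∀ i, 0 < m i := fun i => by
    by_contra h
    have h' : m i = 0 := by omega
    have := hm i
    rw [h', (hw' i).1] at this
    exact hsrc this
  have hinj : Function.Injective fun i => P.trace (σ i) := by
    intro i j hij
    by_contra hne
    -- Equal traces would share their first step, which is a genuine one since the source is not a
    -- target.
    refine hunique i j hne 0 0 ?_ ⟨congrFun hij 0, congrFun hij 1⟩
    rw [htr, Nat.zero_min]
    exact fun h => h _ ((hw' i).2 0 (hm0 i)).1.1
  have hcard : n ≤ (Finset.univ.image fun i => P.trace (σ i)).card := by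
    rw [Finset.card_image_of_injective _ hinj, Finset.card_fin]
    have h := Nat.le_ceil (P.net.value x.f)
    have : (n : ℝ) < (⌈P.net.value x.f⌉₊ : ℝ) + 1 := by linarith
    exact Nat.lt_succ_iff.1 (by exact_mod_cast this)
  obtain ⟨Θ, hΘ, hΘn⟩ := Finset.exists_subset_card_eq hcard
  have hΘ' : ∀ θ ∈ Θ, ∃ i, P.trace (σ i) = θ := fun θ hθ => by simpa using hΘ hθ
  refine ⟨Θ, fun θ hθ => ?_, fun θ hθ θ' hθ' hne => ?_, hΘn⟩
  · obtain ⟨i, rfl⟩ := hΘ' θ hθ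
    exact ⟨_, hσ i, rfl⟩
  · obtain ⟨i, rfl⟩ := hΘ' θ hθ
    obtain ⟨j, rfl⟩ := hΘ' θ' hθ'
    exact hunique i j fun h => hne (by rw [h])

end StrategyOfCuts

end TestProblem

end TestSynth

namespace TestSynth

universe u v w

namespace TestProblem

variable {S : Type u} {A : Type v} {AP : Type w} {P : TestProblem S A AP}
  {env : TestEnv S}

/-! ### From a feasible test strategy to a feasible point. -/

section CutsOfStrategy

variable {Obs : List S → Set (S × S)} {πt : List S → Set A} {Θ : Set (ℕ → P.Node)}

/-- The trace `θ` steps from `x` to `y` before its end. -/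
def Steps (P : TestProblem S A AP) (θ : ℕ → P.Node) (x y : P.Node) : Prop :=
  ∃ k, ¬ P.T.Terminal (θ k).1 ∧ θ k = x ∧ θ (k + 1) = y

/-- The edges of `G` to be cut: those over static obstacles, and those over obstacles placed at the
history variable of their first node, unless a trace in `Θ` uses them. -/
def IsCut (P : TestProblem S A AP) (env : TestEnv S) (Obs : List S → Set (S × S))
    (Θ : Set (ℕ → P.Node)) (e : P.Node × P.Node) : Prop :=
  (e.1.1, e.2.1) ∈ env.staticArea ∧ (e.1.1, e.2.1) ∈ Obs [] ∨
    (e.1.1, e.2.1) ∉ env.staticArea ∧ (e.1.1, e.2.1) ∈ P.obstaclesAt Obs e.1.2 ∧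
      ∀ θ ∈ Θ, ¬ P.Steps θ e.1 e.2

theorem Realizes.mem_strategy_iff (h : P.Realizes env Obs πt) {w : ℕ → P.Node} {m : ℕ}
    (hw : P.IsAllowedWalk πt w m) {a : A} {s : S} (ha : P.T.δ (w m).1 a = some s) :
    a ∈ πt (pre (fun i => (w i).1) m) ↔ ((w m).1, s) ∈ Obs (pre (fun i => (w i).1) m) := by
  rw [h.strategy _ _ (isPrefix_pre (by rw [hw.1]; rfl) fun k hk => (hw.2 k hk).1.1)
    (getLast?_pre _ m)]
  constructor
  · rintro ⟨s', hs', h⟩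
    rw [ha] at hs'
    obtain rfl := Option.some.inj hs'
    exact h
  · exact fun h => ⟨s, ha, h⟩

theorem IsAllowedWalk.mono {w : ℕ → P.Node} {m k : ℕ} (h : P.IsAllowedWalk πt w m) (hk : k ≤ m) :
    P.IsAllowedWalk πt w k :=
  ⟨h.1, fun i hi => h.2 i (by omega)⟩

theorem Realizes.notMem_obs (h : P.Realizes env Obs πt) {w : ℕ → P.Node} {m : ℕ}
    (hw : P.IsAllowedWalk πt w m) {k : ℕ} (hk : k < m) :
    ((w k).1, (w (k + 1)).1) ∉ Obs (pre (fun i => (w i).1) k) := by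
  obtain ⟨-, a, hna, ha⟩ := hw.2 k hk
  rwa [← h.mem_strategy_iff (hw.mono hk.le) ha]

/-- A node is reached by a walk that the test strategy allows. -/
def AllowedReach (P : TestProblem S A AP) (πt : List S → Set A) (x : P.Node) : Prop :=
  ∃ (m : ℕ) (w : ℕ → P.Node), P.IsAllowedWalk πt w m ∧ w m = x

theorem AllowedReach.reach {x : P.Node} (hx : P.AllowedReach πt x) : P.Reach x := by
  obtain ⟨m, w, hw, rfl⟩ := hx
  rw [Reach, ← hw.1]
  exact reflTransGen_of_walk (fun k hk => (hw.2 k hk).1) le_rfl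

theorem exists_isAllowedWalk_of_mem_traces {θ : ℕ → P.Node} (hθ : θ ∈ P.traces πt) {k : ℕ}
    (hk : ¬ P.T.Terminal (θ k).1) : P.IsAllowedWalk πt θ (k + 1) := by
  obtain ⟨σ, ⟨πs, -, hσ⟩, rfl⟩ := hθ
  refine isAllowedWalk_trace hσ fun i hi hterm => hk ?_
  have h : P.T.Terminal (σ k) := by
    rw [hσ.isRun.eq_of_terminal hterm (by omega)]; exact hterm
  exact h

/-- A static obstacle stands at every prefix, so it would also have blocked the trace; non-static
cuts spare the traces by definition. The exemption matters because an edge may be blocked after one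
prefix and free after another with the same history. -/
theorem not_isCut_of_steps (hreal : P.Realizes env Obs πt) (hΘ : Θ ⊆ P.traces πt)
    {θ : ℕ → P.Node} (hθ : θ ∈ Θ) {x y : P.Node} (h : P.Steps θ x y) :
    ¬ P.IsCut env Obs Θ (x, y) := by
  rintro (⟨hst, hobs⟩ | ⟨-, -, hno⟩)
  · obtain ⟨k, hk, rfl, rfl⟩ := h
    refine hreal.notMem_obs (exists_isAllowedWalk_of_mem_traces (hΘ hθ) hk) (Nat.lt_succ_self k) ?_
    exact (hreal.static_const _ hst _ _).1 hobs
  · exact hno θ hθ h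

/-- If a trace in `Θ` uses the edge, that trace itself leads to `y`, and the walk to `x` is
discarded. Otherwise an uncut edge is free of obstacles at every prefix with the history of `x`, so
the walk to `x` extends. -/
theorem AllowedReach.tail (hreal : P.Realizes env Obs πt) (hΘ : Θ ⊆ P.traces πt) {x y : P.Node}
    (hx : P.AllowedReach πt x) (hxy : ProdEdge P.T P.Bπ x y) (hcut : ¬ P.IsCut env Obs Θ (x, y)) :
    P.AllowedReach πt y := by
  by_cases hused : ∃ θ ∈ Θ, P.Steps θ x y
  · obtain ⟨θ, hθ, k, hk, -, rfl⟩ := hused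
    exact ⟨k + 1, θ, exists_isAllowedWalk_of_mem_traces (hΘ hθ) hk, rfl⟩
  · obtain ⟨m, w, hw, rfl⟩ := hx
    obtain ⟨a, ha⟩ := hxy.1
    have hobs : ((w m).1, y.1) ∉ Obs (pre (fun i => (w i).1) m) := by
      intro hobs
      refine hcut ?_
      by_cases hst : ((w m).1, y.1) ∈ env.staticArea
      · exact Or.inl ⟨hst, (hreal.static_const _ hst _ _).1 hobs⟩
      · refine Or.inr ⟨hst, ⟨_, isPrefix_pre (by rw [hw.1]; rfl)
          fun k hk => (hw.2 k hk).1.1, ?_, hobs⟩, fun θ hθ h => hused ⟨θ, hθ, h⟩⟩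
        exact congrArg Prod.snd (trace_of_walk hw.1 (fun k hk => (hw.2 k hk).1) le_rfl)
    rw [← hreal.mem_strategy_iff hw ha] at hobs
    refine ⟨m + 1, fun k => if k ≤ m then w k else y, ⟨by simpa using hw.1, fun k hk => ?_⟩,
      by simp⟩
    have hpre : pre (fun i => (if i ≤ m then w i else y).1) k = pre (fun i => (w i).1) k :=
      pre_congr fun i hi => by rw [if_pos (by omega)]
    rw [hpre]
    rcases Nat.lt_succ_iff_lt_or_eq.1 hk with hk | rfl
    · simpa [hk.le, Nat.succ_le_of_lt hk] using hw.2 k hk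
    · simpa using ⟨hxy, a, hobs, ha⟩

/-- Nodes that are reached over uncut edges without accomplishing the test objective. -/
def BypassReach (P : TestProblem S A AP) (env : TestEnv S) (Obs : List S → Set (S × S))
    (Θ : Set (ℕ → P.Node)) : P.Node → Prop :=
  Relation.ReflTransGen (fun x y => ProdEdge P.T P.Bπ x y ∧ ¬ P.IsCut env Obs Θ (x, y) ∧
    x ∉ P.inter) P.source

theorem BypassReach.allowedReach (hreal : P.Realizes env Obs πt) (hΘ : Θ ⊆ P.traces πt)
    {x : P.Node} (hx : P.BypassReach env Obs Θ x) : P.AllowedReach πt x := by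
  induction hx with
  | refl => exact ⟨0, fun _ => P.source, ⟨rfl, by simp⟩, rfl⟩
  | tail _ h ih => exact ih.tail hreal hΘ h.1 h.2.1

/-- The allowed walk to `x` may differ from the bypass path and may meet intermediate nodes, so only
its end is informative: if `x` were a target, feasibility would make the test accomplished at `x`.
By `hgoal` it is then accomplished at the predecessor on the bypass path. That predecessor has a
successor, so it is no target, and it would be an intermediate node. -/
theorem BypassReach.notMem_target [Nonempty A] (hsys : P.IsSystemObjective)
    (hgoal : P.TestBeforeGoal) (hsrc : P.source ∉ P.target) (hfeas : P.IsFeasible env πt)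
    (hreal : P.Realizes env Obs πt) (hΘ : Θ ⊆ P.traces πt) {x : P.Node}
    (hx : P.BypassReach env Obs Θ x) : x ∉ P.target := by
  intro hT
  obtain ⟨m, w, hw, rfl⟩ := hx.allowedReach hreal hΘ
  obtain ⟨σ, ⟨πs, hcor, hσ⟩, htr⟩ := hw.mem_correctExecutions hsys hT
  have hσm : P.trace σ m = w m := by rw [htr, min_self]
  have hterm : P.T.Terminal (σ m) := by
    have := (hx.allowedReach hreal hΘ).reach.terminal_of_mem_target hsys hT
    rw [← hσm] at this
    exact this
  have hacc := (hσ.isRun.satisfies_iff hterm).2.1 (hfeas.correct_sat πs σ hcor hσ).1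
  rw [hσm] at hacc
  rcases Relation.ReflTransGen.cases_tail hx with h | ⟨y, hy, hyx, -, hI⟩
  · rw [h] at hT; exact hsrc hT
  · have hyr := (BypassReach.allowedReach hreal hΘ hy).reach
    exact hI ⟨hgoal y _ hyr hyx hT hacc, fun hyT => hyr.terminal_of_mem_target hsys hyT _ hyx.1⟩

variable [Fintype S]

/-- The single path left open by the obstacles carries one unit of flow. -/
theorem exists_sysFlow (hleaves : P.LeavesPath env Obs) (henv : env ≠ .static) (q : P.Bπ.Q)
    (u : P.SysNode) (hu : u ∈ P.sysSources (P.firstObs q)) :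
    ∃ g, (P.sysNet u).IsFlow g ∧ (P.sysNet u).value g = 1 ∧
      ∀ e, g e ≠ 0 → (e.1.1, e.2.1) ∉ P.obstaclesAt Obs q := by
  have hpath := hleaves q u (by cases env <;> first | exact absurd rfl henv | exact hu)
  obtain ⟨g, hg, hval, hsupp⟩ := FlowNetwork.exists_flow_of_disjoint (N := P.sysNet u)
    (ι := Unit) (s := u) rfl hu.1 (fun _ x y => ProdEdge P.T P.Bsys x y ∧
      (x.1, y.1) ∉ P.obstaclesAt Obs q) (fun _ x y h hne => ⟨h.1, hne⟩)
    (fun _ _ _ _ _ _ _ => rfl) fun _ => hpath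
  refine ⟨g, hg, by simpa using hval, fun e he => ?_⟩
  obtain ⟨-, h⟩ := hsupp e he
  exact h.2

/-- A feasible test strategy with `n` unique traces yields a feasible point with flow value `n`. -/
theorem exists_milpFeasible_of_hasUniqueTraces [Nonempty A] (hsys : P.IsSystemObjective)
    (hgoal : P.TestBeforeGoal) (hsrc : P.source ∉ P.target) (hfeas : P.IsFeasible env πt) {n : ℕ}
    (hn : P.HasUniqueTraces πt n) :
    ∃ x, P.MILPFeasible env x ∧ P.net.value x.f = n := by
  obtain ⟨Θ, hΘ, hpair, rfl⟩ := hn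
  obtain ⟨Obs, hreal, hleaves⟩ := hfeas.realizable
  obtain ⟨f, hf, hval, hsupp⟩ := FlowNetwork.exists_flow_of_disjoint (N := P.net)
    (ι := Θ) (s := P.source) rfl hsrc (fun θ => P.Steps θ.1)
    (fun θ x y ⟨k, hk, hx, hy⟩ hne => ⟨by
      rw [← hx, ← hy]
      exact ((exists_isAllowedWalk_of_mem_traces (hΘ θ.2) hk).2 k (Nat.lt_succ_self k)).1, hne⟩)
    (fun θ θ' x y ⟨k, hk, hx, hy⟩ ⟨l, _, hx', hy'⟩ _ => by
      by_contra hne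
      exact hpair θ.2 θ'.2 (fun h => hne (Subtype.ext h)) k l hk
        ⟨hx.trans hx'.symm, hy.trans hy'.symm⟩)
    (fun θ => by
      obtain ⟨σ, ⟨πs, ⟨σ', hσ', hs⟩, hσ⟩, hθ⟩ := hΘ θ.2
      obtain rfl := hσ'.unique hσ
      obtain ⟨m, hm, -, hmin⟩ := hσ.isRun.exists_mem_target hsys hs
      rw [hθ] at hm
      refine ⟨θ.1 m, hm, ?_⟩
      have h0 : θ.1 0 = P.source := by rw [← hθ]; exact trace_zero hσ.1
      rw [← h0]
      refine reflTransGen_of_walk (fun k hk => ⟨k, ?_, rfl, rfl⟩) le_rfl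
      rw [← hθ]
      exact hmin k hk)
  have hsysflow : ∀ q u, ∃ g, env ≠ .static → u ∈ P.sysSources (P.firstObs q) →
      (P.sysNet u).IsFlow g ∧ (P.sysNet u).value g = 1 ∧
        ∀ e, g e ≠ 0 → (e.1.1, e.2.1) ∉ P.obstaclesAt Obs q := by
    intro q u
    by_cases h : env ≠ .static ∧ u ∈ P.sysSources (P.firstObs q)
    · obtain ⟨g, hg⟩ := exists_sysFlow hleaves h.1 q u h.2
      exact ⟨g, fun _ _ => hg⟩
    · exact ⟨0, fun h1 h2 => absurd ⟨h1, h2⟩ h⟩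
  choose g hg using hsysflow
  have hd : ∀ e, (if P.IsCut env Obs Θ e then (1 : ℝ) else 0) ≤ 1 := fun e => by
    split_ifs <;> norm_num
  -- The potential is the indicator of `BypassReach`: it is one at the source and zero on the
  -- target, and it can drop outside the intermediate nodes only across a cut.
  refine ⟨⟨f, fun e => if P.IsCut env Obs Θ e then 1 else 0,
    fun v => if P.BypassReach env Obs Θ v then 1 else 0, g⟩, ?_, ?_⟩
  · constructor
    case binary => intro e _; dsimp only; split_ifs <;> simp
    case harness =>
      intro e _ hr
      refine if_neg fun hcut => hr ?_
      rcases hcut with ⟨-, h⟩ | ⟨-, ⟨l, -, -, h⟩, -⟩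
      · exact hreal.harness _ _ h
      · exact hreal.harness _ _ h
    case flow => exact hf
    case cut =>
      intro e he
      dsimp only
      by_cases h : f e = 0
      · rw [h, add_zero]; exact hd e
      · obtain ⟨θ, hθ⟩ := hsupp e h
        rw [if_neg (not_isCut_of_steps hreal hΘ θ.2 hθ), zero_add]
        exact (hf.capacity e he).2
    case potential => intro v _; dsimp only; split_ifs <;> norm_num
    case separation =>
      intro v hv _ _
      dsimp only
      rw [if_pos (show P.BypassReach env Obs Θ P.source from .refl), if_neg fun h : P.BypassReach env Obs Θ v =>
        h.notMem_target hsys hgoal hsrc hfeas hreal hΘ hv]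
      norm_num
    case partition =>
      intro e he hI _
      dsimp only
      by_cases h1 : P.BypassReach env Obs Θ e.1 <;> by_cases hcut : P.IsCut env Obs Θ e
      · rw [if_pos hcut, if_pos h1]; split_ifs <;> norm_num
      · have h2 : P.BypassReach env Obs Θ e.2 :=
          Relation.ReflTransGen.tail h1 ⟨(FlowNetwork.mem_edges.1 he).1, hcut, hI⟩
        rw [if_neg hcut, if_pos h1, if_pos h2]; norm_num
      · rw [if_pos hcut, if_neg h1]; split_ifs <;> norm_num
      · rw [if_neg hcut, if_neg h1]; split_ifs <;> norm_num
    case sysFlow => exact fun henv q u hu => (hg q u henv hu).1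
    case sysValue => exact fun henv q u hu => (hg q u henv hu).2.1.ge
    case sysCut =>
      intro henv q u hu e _ hq e' he' h1 h2
      dsimp only
      obtain ⟨hflow, -, hobs⟩ := hg q u henv hu
      by_cases h : g q u e' = 0
      · rw [h, add_zero]; exact hd e
      · rw [if_neg, zero_add]
        · exact (hflow.capacity e' he').2
        · intro hcut
          refine hobs e' h ?_
          rw [h1, h2]
          rcases hcut with ⟨hst, hcut⟩ | ⟨-, hcut, -⟩
          -- The history `q` is observed at a reachable node, so some prefix realizes it, and the
          -- static obstacle stands at that prefix as well.
          · obtain ⟨-, ⟨x, ⟨rfl, hx, -⟩, -⟩, -⟩ := hu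
            obtain ⟨l, hl, hlq⟩ := hx.exists_prefix
            exact ⟨l, hl, hlq, (hreal.static_const _ hst _ _).1 hcut⟩
          · rwa [hq] at hcut
    case static_cuts =>
      intro e _ e' _ h1 h2 hst
      dsimp only
      have key : P.IsCut env Obs Θ e ↔ P.IsCut env Obs Θ e' := by
        unfold IsCut
        rw [← h1, ← h2]
        simp only [hst, true_and, not_true_eq_false, false_and, or_false]
      simp only [key]
  · rw [← Fintype.card_coe]
    exact hval

end CutsOfStrategy

end TestProblem

end TestSynth

/-! ### Comparison of the optimum with an arbitrary feasible strategy. -/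

theorem mainTheorem1 {S : Type*} {A : Type*} {AP : Type*} [Fintype S]
    (P : TestSynth.TestProblem S A AP) (env : TestSynth.TestEnv S)
    (hsys : P.IsSystemObjective) (htest : P.IsTestObjective) (hgoal : P.TestBeforeGoal)
    (hcons : P.Consistent env) :
    (∃ x, P.IsOptimal env x) ∧
      ∀ x, P.IsOptimal env x → P.Solves env (P.testStrategy x.d) := by
  obtain ⟨x₀, hx₀, hval₀⟩ := hcons
  have hpos₀ : 0 < P.net.value x₀.f := by linarith
  refine ⟨TestSynth.TestProblem.exists_isOptimal hx₀, fun x hx => ?_⟩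
  -- Consistency gives a point of value at least one, and an optimum falls short of it by less than
  -- one.
  have hpos : 0 < P.net.value x.f := by linarith [hx.lt_value hx₀ hpos₀]
  refine ⟨TestSynth.TestProblem.isFeasible_testStrategy hsys htest hx.1 hpos,
    fun πt hfeas n hn => ?_⟩
  have := TestSynth.TestProblem.nonempty_action_of_value_pos hx₀.flow hpos₀
  obtain ⟨y, hy, hyn⟩ := TestSynth.TestProblem.exists_milpFeasible_of_hasUniqueTraces hsys hgoal
    (TestSynth.TestProblem.source_notMem_target_of_value_pos hx₀.flow hpos₀) hfeas hn
  refine TestSynth.TestProblem.hasUniqueTraces_testStrategy hsys hx.1 hpos ?_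
  -- The penalty bound needs a positive flow, so `n = 0` is treated apart.
  rcases Nat.eq_zero_or_pos n with rfl | hn0
  · push_cast; linarith
  · have hypos : 0 < P.net.value y.f := by rw [hyn]; exact_mod_cast hn0
    have := hx.lt_value hy hypos
    rw [hyn] at this
    linarith
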